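/- **Theorem ($KS_r^\infty$).** Let $I$ be an at most countable (finite or countably infinite, possibly empty) index set and let $\mathcal H$ be a separable Hilbert space over $\mathbb R$ or $\mathbb C$. Let $\delta \ge 0$ be a real number and let $\{u_i\}_{i\in I}\subset\mathcal H$ be a Bessel sequence with bound $1$ such that $\|u_i\|^2\le\delta$ for all $i \in I$; that is, $$\sum_{i\in I}|\langle u,u_i\rangle|^2\le \|u\|^2\quad\text{for all }u\in\mathcal H\qquad\text{and}\qquad \|u_i\|^2\le\delta\quad\text{for all } i\in I.$$ Then for every positive integer $r$ there exists a partition $\{I_1,\dots,I_r\}$ of $I$ into $r$ pairwise disjoint (possibly empty) subsets with union $I$ such that for each $k=1,\dots,r$ the family $\{u_i\}_{i\in I_k}$ is a Bessel sequence with bound $\left(\frac1{\sqrt r}+\sqrt\delta\right)^2$, i.e. $$\sum_{i\in I_k}|\langle u,u_i\rangle|^2\le\left(\frac1{\sqrt r}+\sqrt\delta\right)^2\|u\|^2\quad\text{for all }u\in\mathcal H.$$ -/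

import Mathlib

/-- A family `u` of vectors of an inner product space `H` is a Bessel sequence with (not necessarily
optimal) Bessel bound `B` if `∑ i, |⟨x, u i⟩|² ≤ B ‖x‖²` for all `x`. The convergence of the series
is part of the definition. -/
def IsBesselSequence (𝕜 : Type*) {H ι : Type*} [RCLike 𝕜] [NormedAddCommGroup H]
    [InnerProductSpace 𝕜 H] (u : ι → H) (B : ℝ) : Prop :=
  ∀ x : H, Summable (fun i => ‖inner 𝕜 x (u i)‖ ^ 2) ∧
    ∑' i, ‖inner 𝕜 x (u i)‖ ^ 2 ≤ B * ‖x‖ ^ 2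

/-- The sets `P 1, …, P r` form a partition of `ι` into `r` subsets: they are pairwise disjoint and
cover `ι`. Some of them may be empty (as they must be when `ι` has fewer than `r` elements). -/
def IsPartitionInto {ι : Type*} (r : ℕ) (P : Fin r → Set ι) : Prop :=
  (∀ j k, j ≠ k → Disjoint (P j) (P k)) ∧ ⋃ k, P k = Set.univ

/-! For a finite family the statement follows from the theorem of Marcus, Spielman and Srivastava:
independent random matrices `v vᴴ` whose expected sum is at most the identity, with expected squared
norms `‖v‖²` at most `ε`, have an outcome whose sum is at most `(1 + √ε)²`. Colour each `i`
uniformly at random and put `√r` times the coordinates of `u i` into the block of its colour. Then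
`ε = r δ`, an outcome is a colouring, each diagonal block controls one colour class, and division by
`r` gives the constant (`exists_coloring_sum_norm_inner_sq_le`). Compactness of the space of
colourings handles infinite families.

The random matrix theorem is proved with the stable polynomial `det (z₀ + ∑ zₐ vₐ vₐᴴ)`, which has
one variable per index and outcome and is affine in each `zₐ`. There `1 - ∂ₐ` acts as the shift `zₐ
↦ zₐ - 1`, so applying these operators for one choice of outcomes and restricting to the `z₀` axis
gives the characteristic polynomial of the chosen sum. Averaging the directions of differentiation
averages over outcomes. Interlacing (`IsStable.exists_choice_foldr`) finds a choice that is positive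
wherever the averaged polynomial guarantees it, and the barrier argument (`IsStable.isAbove_foldr`)
shows the averaged polynomial to be positive beyond `(1 + √ε)²`.

Both arguments rest on one fact: along a line in a nonnegative direction, the quotient `D_w f / f`
of a stable `f` maps the upper half plane to the closed lower one. It therefore decreases between
poles. If the direction is also positive in the distinguished variable, it is a sum of terms `c / (t
- ρ)` with `c ≥ 0` (`IsAntiPick.exists_partialFraction`), so it is convex to the right of its poles.
-/

section

/-! ### Univariate anti-Pick quotients: monotonicity, partial fractions, convexity. -/

open Polynomial Filter Topology ComplexConjugate

/-- The quotient `q / p` of two real polynomials maps the open upper half plane to the closed lower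
half plane. -/
def IsAntiPick (p q : ℝ[X]) : Prop :=
  ∀ s : ℂ, 0 < s.im → (aeval s q * conj (aeval s p)).im ≤ 0

/-- The function `η ↦ Im (q * conj p)(t + iη)` vanishes at `0` and is nonpositive for `η > 0`; its
derivative at `0` is the Wronskian. No division occurs, so zeros of `p` are allowed. -/
theorem IsAntiPick.wronskian_nonpos {p q : ℝ[X]} (h : IsAntiPick p q) (t : ℝ) :
    (derivative q).eval t * p.eval t - q.eval t * (derivative p).eval t ≤ 0 := by
  have hl : HasDerivAt (fun η : ℝ => (t : ℂ) + (η : ℂ) * Complex.I) Complex.I 0 := by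
    simpa using ((Complex.ofRealCLM.hasDerivAt (x := (0 : ℝ))).mul_const Complex.I).const_add (t : ℂ)
  have hd : ∀ f : ℝ[X], HasDerivAt (fun η : ℝ => aeval ((t : ℂ) + (η : ℂ) * Complex.I) f)
      (((derivative f).eval t : ℝ) * Complex.I) 0 := by
    intro f
    have h1 : HasDerivAt (fun z : ℂ => aeval z f) (aeval ((t : ℂ) + ((0 : ℝ) : ℂ) * Complex.I)
      (derivative f)) ((t : ℂ) + ((0 : ℝ) : ℂ) * Complex.I) := Polynomial.hasDerivAt_aeval _ _
    have h2 := HasDerivAt.comp (𝕜 := ℝ) (𝕜' := ℂ) (0 : ℝ) h1 hl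
    have e := Polynomial.aeval_algebraMap_apply_eq_algebraMap_eval (A := ℂ) t (derivative f)
    simp only [Complex.coe_algebraMap] at e
    exact h2.congr_deriv (by simp [e])
  have hprod := (hd q).mul ((hd p).star)
  have him := (Complex.imCLM.hasFDerivAt.comp_hasDerivAt (0 : ℝ) hprod)
  have ht := him.tendsto_slope_zero_right
  have e : ∀ f : ℝ[X], aeval (t : ℂ) f = ((f.eval t : ℝ) : ℂ) := by
    intro f
    simpa using Polynomial.aeval_algebraMap_apply_eq_algebraMap_eval (A := ℂ) t f
  have hle := le_of_tendsto (b := 0) ht (by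
    filter_upwards [self_mem_nhdsWithin] with η hη
    have hη : 0 < η := hη
    have := h ((t : ℂ) + (η : ℂ) * Complex.I) (by simpa using hη)
    refine smul_nonpos_of_nonneg_of_nonpos (inv_nonneg.2 hη.le) ?_
    simpa [e] using this)
  simp only [Complex.imCLM_apply, Complex.ofReal_zero, zero_mul, add_zero, e] at hle
  simp at hle
  linarith

theorem splits_of_forall_aeval_ne_zero {p : ℝ[X]} (h : ∀ s : ℂ, 0 < s.im → aeval s p ≠ 0) :
    p.Splits := by
  refine Splits.of_splits_map (algebraMap ℝ ℂ) (IsAlgClosed.splits _) fun a ha => ?_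
  have ha : aeval a p = 0 := by
    rw [aeval_def, eval₂_eq_eval_map]
    exact (mem_roots'.1 ha).2
  have h1 : ¬ 0 < a.im := fun hh => h a hh ha
  have h2 : ¬ 0 < (conj a).im := fun hh => h _ hh (by rw [aeval_conj, ha, map_zero])
  simp only [Complex.conj_im] at h2
  exact ⟨a.re, Complex.ext (by simp) (by simp; linarith)⟩

/-- Near a root of order `m`, with `p = (X - ρ)^m g`, the product `q * conj p` at `ρ + ηζ` behaves
like `η^m q(ρ) g(ρ) conj (ζ^m)`. For `m ≥ 2` the powers `ζ^m` of upper half plane points take both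
signs of imaginary part. -/
theorem IsAntiPick.rootMultiplicity_le_one {p q : ℝ[X]} (h : IsAntiPick p q) (hp : p ≠ 0) {ρ : ℝ}
    (hq : q.eval ρ ≠ 0) : p.rootMultiplicity ρ ≤ 1 := by
  by_contra! hm
  obtain ⟨g, hg, hng⟩ := exists_eq_pow_rootMultiplicity_mul_and_not_dvd p hp ρ
  set m := p.rootMultiplicity ρ
  have hgρ : g.eval ρ ≠ 0 := fun h0 => hng (dvd_iff_isRoot.2 h0)
  have key : ∀ ζ : ℂ, 0 < ζ.im → (((q.eval ρ * g.eval ρ : ℝ) : ℂ) * conj (ζ ^ m)).im ≤ 0 := by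
    intro ζ hζ
    have hc : ∀ f : ℝ[X], Tendsto (fun η : ℝ => aeval ((ρ : ℂ) + (η : ℂ) * ζ) f) (𝓝[>] 0)
        (𝓝 ((f.eval ρ : ℝ) : ℂ)) := by
      intro f
      have : Continuous (fun η : ℝ => aeval ((ρ : ℂ) + (η : ℂ) * ζ) f) := by fun_prop
      have := (this.tendsto 0).mono_left (nhdsWithin_le_nhds (s := Set.Ioi (0 : ℝ)))
      have e := Polynomial.aeval_algebraMap_apply_eq_algebraMap_eval (A := ℂ) ρ f
      simp only [Complex.coe_algebraMap] at e
      simpa [e] using this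
    have ht : Tendsto (fun η : ℝ => ((aeval ((ρ : ℂ) + (η : ℂ) * ζ) q *
        conj (aeval ((ρ : ℂ) + (η : ℂ) * ζ) g)) * conj (ζ ^ m)).im) (𝓝[>] 0)
        (𝓝 ((((q.eval ρ : ℝ) : ℂ) * conj ((g.eval ρ : ℝ) : ℂ) * conj (ζ ^ m)).im)) :=
      (Complex.continuous_im.tendsto _).comp
        (((hc q).mul ((Complex.continuous_conj.tendsto _).comp (hc g))).mul_const _)
    have : (((q.eval ρ : ℝ) : ℂ) * conj ((g.eval ρ : ℝ) : ℂ) * conj (ζ ^ m)).im ≤ 0 := by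
      refine le_of_tendsto ht ?_
      filter_upwards [self_mem_nhdsWithin] with η hη
      have hη : 0 < η := hη
      have h1 := h ((ρ : ℂ) + (η : ℂ) * ζ) (by simpa using mul_pos hη hζ)
      have h2 : aeval ((ρ : ℂ) + (η : ℂ) * ζ) p = ((η ^ m : ℝ) : ℂ) *
          (ζ ^ m * aeval ((ρ : ℂ) + (η : ℂ) * ζ) g) := by
        conv_lhs => rw [hg]
        simp only [map_mul, map_pow, map_sub, aeval_X, aeval_C, Complex.coe_algebraMap,
          add_sub_cancel_left, mul_pow, Complex.ofReal_pow]
        ring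
      rw [h2, map_mul, Complex.conj_ofReal, mul_left_comm, Complex.im_ofReal_mul] at h1
      have h3 := nonpos_of_mul_nonpos_right h1 (pow_pos hη m)
      convert h3 using 2
      rw [map_mul]; ring
    simpa only [Complex.conj_ofReal, ← Complex.ofReal_mul] using this
  have hm0 : (m : ℂ) ≠ 0 := by exact_mod_cast (by omega : m ≠ 0)
  have hmR : (2 : ℝ) ≤ m := by exact_mod_cast hm
  have hπ := Real.pi_pos
  -- These two unit vectors have `m`-th powers `i` and `-i`; the second lies in the upper half plane
  -- because `m ≥ 2`.
  have k1 := key (Complex.exp (((Real.pi / (2 * m) : ℝ) : ℂ) * Complex.I)) (by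
    rw [Complex.exp_ofReal_mul_I_im]
    refine Real.sin_pos_of_pos_of_lt_pi (by positivity) ?_
    rw [div_lt_iff₀ (by positivity)]; nlinarith)
  have k2 := key (Complex.exp (((3 * Real.pi / (2 * m) : ℝ) : ℂ) * Complex.I)) (by
    rw [Complex.exp_ofReal_mul_I_im]
    refine Real.sin_pos_of_pos_of_lt_pi (by positivity) ?_
    rw [div_lt_iff₀ (by positivity)]; nlinarith)
  rw [← Complex.exp_nat_mul] at k1 k2
  have e1 : (m : ℂ) * (((Real.pi / (2 * m) : ℝ) : ℂ) * Complex.I) =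
      ((Real.pi / 2 : ℝ) : ℂ) * Complex.I := by push_cast; field_simp
  have e2 : (m : ℂ) * (((3 * Real.pi / (2 * m) : ℝ) : ℂ) * Complex.I) =
      ((Real.pi / 2 + Real.pi: ℝ) : ℂ) * Complex.I := by push_cast; field_simp; ring
  rw [e1, Complex.im_ofReal_mul, Complex.conj_im, Complex.exp_ofReal_mul_I_im,
    Real.sin_pi_div_two] at k1
  rw [e2, Complex.im_ofReal_mul, Complex.conj_im, Complex.exp_ofReal_mul_I_im,
    Real.sin_add_pi, Real.sin_pi_div_two] at k2
  exact mul_ne_zero hq hgρ (by linarith)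

/-- Common roots are cancelled by induction on the degree. Without them all roots of `p` are simple,
Lagrange interpolation at the roots yields residues `q(ρ) / p'(ρ)`, and the Wronskian at `ρ`, which
is `-q(ρ) p'(ρ)`, gives their sign. -/
theorem IsAntiPick.exists_partialFraction {p : ℝ[X]} (hs : p.Splits) {q : ℝ[X]}
    (h : IsAntiPick p q) (hd : q.degree < p.degree) :
    ∃ (S : Finset ℝ) (c : ℝ → ℝ), (∀ ρ ∈ S, 0 ≤ c ρ ∧ p.eval ρ = 0) ∧
      ∀ t, p.eval t ≠ 0 → q.eval t / p.eval t = ∑ ρ ∈ S, c ρ / (t - ρ) := by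
  induction hn : p.natDegree generalizing p q with
  | zero =>
    have hp : p.degree ≤ 0 := natDegree_eq_zero_iff_degree_le_zero.1 hn
    have hq : q = 0 := by
      rw [← degree_eq_bot]
      exact Nat.WithBot.lt_zero_iff.1 (hd.trans_le hp)
    exact ⟨∅, 0, by simp, by simp [hq]⟩
  | succ n ih =>
    have hp0 : p ≠ 0 := by rintro rfl; simp at hn
    by_cases hc : ∃ ρ, p.eval ρ = 0 ∧ q.eval ρ = 0
    · obtain ⟨ρ, hpρ, hqρ⟩ := hc
      obtain ⟨p₁, rfl⟩ := dvd_iff_isRoot.2 hpρ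
      obtain ⟨q₁, rfl⟩ := dvd_iff_isRoot.2 hqρ
      have hp1 : p₁ ≠ 0 := right_ne_zero_of_mul hp0
      have hdeg : p₁.natDegree = n := by
        rw [natDegree_mul (X_sub_C_ne_zero ρ) hp1, natDegree_X_sub_C] at hn; omega
      have hpick : IsAntiPick p₁ q₁ := by
        intro s hs
        have h1 := h s hs
        have hne : s - ρ ≠ 0 := fun h0 => by
          have := congrArg Complex.im h0
          simp at this; exact hs.ne' this
        have h2 : aeval s ((X - C ρ) * q₁) * conj (aeval s ((X - C ρ) * p₁)) =
            ((Complex.normSq (s - ρ) : ℝ) : ℂ) * (aeval s q₁ * conj (aeval s p₁)) := by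
          rw [← Complex.mul_conj]
          simp only [map_mul, map_sub, aeval_X, aeval_C, Complex.coe_algebraMap]
          ring
        rw [h2, Complex.im_ofReal_mul] at h1
        exact nonpos_of_mul_nonpos_right h1 (Complex.normSq_pos.2 hne)
      have hd' : q₁.degree < p₁.degree := by
        rw [degree_mul, degree_mul] at hd
        exact lt_of_add_lt_add_left hd
      obtain ⟨S, c, hS, hc⟩ := ih (hs.of_dvd hp0 (Dvd.intro_left _ rfl)) hpick hd' hdeg
      refine ⟨S, c, fun ρ' h' => ⟨(hS ρ' h').1, by simp [(hS ρ' h').2]⟩, fun t ht => ?_⟩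
      simp only [eval_mul] at ht ⊢
      rw [mul_div_mul_left _ _ (left_ne_zero_of_mul ht), hc t (right_ne_zero_of_mul ht)]
    · push Not at hc
      have hnd : p.roots.Nodup := by
        rw [Multiset.nodup_iff_count_le_one]
        intro ρ
        rw [count_roots]
        by_cases hr : p.eval ρ = 0
        · exact h.rootMultiplicity_le_one hp0 (hc ρ hr)
        · rw [rootMultiplicity_eq_zero hr]; exact zero_le_one
      have hmem : ∀ ρ, ρ ∈ p.roots.toFinset ↔ p.eval ρ = 0 := by
        intro ρ; simp [hp0]
      have hprod : p = C p.leadingCoeff * Lagrange.nodal p.roots.toFinset id := by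
        conv_lhs => rw [hs.eq_prod_roots]
        congr 1
        rw [Lagrange.nodal, Finset.prod_eq_multiset_prod, Multiset.toFinset_val,
          hnd.dedup]
        rfl
      have hlc : p.leadingCoeff ≠ 0 := leadingCoeff_ne_zero.2 hp0
      have hder : ∀ ρ ∈ p.roots.toFinset, Lagrange.nodalWeight p.roots.toFinset id ρ =
          p.leadingCoeff / (derivative p).eval ρ := by
        intro ρ hρ
        rw [Lagrange.nodalWeight_eq_eval_derivative_nodal hρ]
        conv_rhs => rw [hprod]
        simp only [derivative_C_mul, eval_mul, eval_C, id, leadingCoeff_mul, leadingCoeff_C,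
          (Lagrange.nodal_monic).leadingCoeff, mul_one]
        rw [div_mul_cancel_left₀ hlc]
      have hq : q = Lagrange.interpolate p.roots.toFinset id (fun ρ => q.eval ρ) := by
        refine Lagrange.eq_interpolate_of_eval_eq _ (Function.injective_id.injOn) ?_ (fun _ _ => rfl)
        rw [Multiset.toFinset_card_of_nodup hnd, ← hs.natDegree_eq_card_roots,
          ← degree_eq_natDegree hp0]
        exact hd
      refine ⟨p.roots.toFinset, fun ρ => q.eval ρ / (derivative p).eval ρ, fun ρ hρ =>
        ⟨?_, (hmem ρ).1 hρ⟩, fun t ht => ?_⟩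
      · have := h.wronskian_nonpos ρ
        rw [(hmem ρ).1 hρ] at this
        rcases le_total 0 (q.eval ρ) with h0 | h0
        · rcases h0.eq_or_lt with h1 | h1
          · simp [← h1]
          · exact div_nonneg h0 (by nlinarith)
        · rcases h0.eq_or_lt with h1 | h1
          · simp [h1]
          · exact div_nonneg_of_nonpos h0 (by nlinarith)
      · have hne : ∀ ρ ∈ p.roots.toFinset, t ≠ id ρ := by
          rintro ρ hρ rfl
          exact ht ((hmem _).1 hρ)
        have h1 : q.eval t = (Lagrange.nodal p.roots.toFinset id).eval t *
            ∑ ρ ∈ p.roots.toFinset, Lagrange.nodalWeight p.roots.toFinset id ρ *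
              (t - id ρ)⁻¹ * q.eval ρ := by
          conv_lhs => rw [hq]
          exact Lagrange.eval_interpolate_not_at_node _ hne
        have h2 : p.eval t = p.leadingCoeff * (Lagrange.nodal p.roots.toFinset id).eval t := by
          conv_lhs => rw [hprod]
          simp
        rw [h2] at ht
        rw [h1, h2, mul_comm p.leadingCoeff, mul_div_mul_left _ _ (right_ne_zero_of_mul ht),
          Finset.sum_div]
        refine Finset.sum_congr rfl fun ρ hρ => ?_
        rw [hder ρ hρ, id]
        have := sub_ne_zero.2 (hne ρ hρ)
        simp only [id] at this
        field_simp

/-- Convexity of an anti-Pick quotient to the right of its poles. -/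
theorem IsAntiPick.sub_le_mul_wronskian {p q : ℝ[X]} (h : IsAntiPick p q) (hs : p.Splits)
    (hd : q.degree < p.degree) {a b : ℝ} (hab : a ≤ b) (hp : ∀ t, a ≤ t → p.eval t ≠ 0) :
    q.eval b / p.eval b - q.eval a / p.eval a ≤ (b - a) *
      (((derivative q).eval b * p.eval b - q.eval b * (derivative p).eval b) / p.eval b ^ 2) := by
  obtain ⟨S, c, hS, hc⟩ := h.exists_partialFraction hs hd
  have hlt : ∀ ρ ∈ S, ρ < a := fun ρ hρ => by
    by_contra! hh
    exact hp ρ hh (hS ρ hρ).2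
  have h1 : HasDerivAt (fun t => q.eval t / p.eval t) (((derivative q).eval b * p.eval b -
      q.eval b * (derivative p).eval b) / p.eval b ^ 2) b :=
    (q.hasDerivAt b).div (p.hasDerivAt b) (hp b hab)
  have h2 : HasDerivAt (fun t => ∑ ρ ∈ S, c ρ / (t - ρ)) (∑ ρ ∈ S, -(c ρ / (b - ρ) ^ 2)) b := by
    refine HasDerivAt.fun_sum fun ρ hρ => ?_
    have hne : b - ρ ≠ 0 := by linarith [hlt ρ hρ] |> fun (h : 0 < b - ρ) => h.ne'
    have := (hasDerivAt_const b (c ρ)).div ((hasDerivAt_id b).sub_const ρ) hne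
    exact this.congr_deriv (by simp [neg_div])
  have heq : (fun t => q.eval t / p.eval t) =ᶠ[𝓝 b] (fun t => ∑ ρ ∈ S, c ρ / (t - ρ)) := by
    have : ∀ᶠ t in 𝓝 b, p.eval t ≠ 0 := p.continuous.continuousAt.eventually_ne (hp b hab)
    filter_upwards [this] with t ht using hc t ht
  rw [(h2.congr_of_eventuallyEq heq).unique h1 |>.symm, hc b (hp b hab), hc a (hp a le_rfl),
    ← Finset.sum_sub_distrib, Finset.mul_sum]
  refine Finset.sum_le_sum fun ρ hρ => ?_
  have ha : 0 < a - ρ := by linarith [hlt ρ hρ]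
  have hb : 0 < b - ρ := by linarith
  have hcn := (hS ρ hρ).1
  -- Tangent inequality at `b` for a single convex term, with the explicit defect.
  have : c ρ / (b - ρ) - c ρ / (a - ρ) - (b - a) * -(c ρ / (b - ρ) ^ 2) =
      - (c ρ * (b - a) ^ 2 / ((a - ρ) * (b - ρ) ^ 2)) := by
    field_simp; ring
  have h3 : 0 ≤ c ρ * (b - a) ^ 2 / ((a - ρ) * (b - ρ) ^ 2) := by positivity
  linarith

theorem IsAntiPick.antitoneOn {p q : ℝ[X]} (h : IsAntiPick p q) {s : Set ℝ} (hs : Convex ℝ s)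
    (hp : ∀ t ∈ s, p.eval t ≠ 0) : AntitoneOn (fun t => q.eval t / p.eval t) s := by
  have hder : ∀ t ∈ s, HasDerivAt (fun t => q.eval t / p.eval t) (((derivative q).eval t * p.eval t -
      q.eval t * (derivative p).eval t) / p.eval t ^ 2) t := fun t ht =>
    (q.hasDerivAt t).div (p.hasDerivAt t) (hp t ht)
  refine antitoneOn_of_deriv_nonpos hs (fun t ht => (hder t ht).continuousAt.continuousWithinAt)
    (fun t ht => (hder t (interior_subset ht)).differentiableAt.differentiableWithinAt)
    fun t ht => ?_
  rw [(hder t (interior_subset ht)).deriv]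
  exact div_nonpos_of_nonpos_of_nonneg (h.wronskian_nonpos t) (sq_nonneg _)

/-- The quotient `q / p` is decreasing on the ray and tends to `0` at infinity. -/
theorem IsAntiPick.nonneg_of_forall_pos {p q : ℝ[X]} (h : IsAntiPick p q)
    (hd : q.degree < p.degree) {l : ℝ} (hp : ∀ t, l < t → 0 < p.eval t) {t : ℝ} (ht : l < t) :
    0 ≤ q.eval t := by
  have h1 : AntitoneOn (fun t => q.eval t / p.eval t) (Set.Ioi l) :=
    h.antitoneOn (convex_Ioi l) fun t ht => (hp t ht).ne'
  have h2 := Polynomial.div_tendsto_atTop_zero_of_degree_lt q p hd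
  have h3 : 0 ≤ q.eval t / p.eval t := by
    refine le_of_tendsto h2 ?_
    filter_upwards [eventually_ge_atTop t] with s hs
    exact h1 ht (lt_of_lt_of_le ht hs) hs
  simpa [div_mul_cancel₀ _ (hp t ht).ne'] using mul_nonneg h3 (hp t ht).le

/-- If `p - q` is positive on `(l, ∞)`, then so is `p`. -/
theorem IsAntiPick.pos_of_sub_pos {p q : ℝ[X]} (h : IsAntiPick p q) (hd : q.degree < p.degree)
    (hlead : 0 < p.leadingCoeff) {l : ℝ} (hpq : ∀ t, l < t → 0 < p.eval t - q.eval t) {t : ℝ}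
    (ht : l < t) : 0 < p.eval t := by
  have hp0 : p ≠ 0 := by rintro rfl; simp at hlead
  have htop : ∀ᶠ x in atTop, 0 < p.eval x := by
    rcases eq_or_ne p.natDegree 0 with h0 | h0
    · rw [eq_C_of_natDegree_eq_zero h0] at hlead ⊢
      exact Eventually.of_forall fun x => by simpa using hlead
    · exact (p.tendsto_atTop_of_leadingCoeff_nonneg (natDegree_pos_iff_degree_pos.1
        (Nat.pos_of_ne_zero h0)) hlead.le).eventually_gt_atTop 0
  obtain ⟨B, hB⟩ := eventually_atTop.1 htop
  by_contra! hneg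
  have hB1 := hB (max t B) (le_max_right _ _)
  have hzero : ∃ x ∈ Set.Icc t (max t B), p.eval x = 0 :=
    intermediate_value_Icc (le_max_left t B) p.continuous.continuousOn ⟨hneg, hB1.le⟩
  obtain ⟨x, hx, hx0⟩ := hzero
  -- At the largest root `m` of `p`, continuity from the right gives `q(m) ≥ 0`, whereas `p(m) -
  -- q(m) > 0` forces `q(m) < 0`.
  set R := p.roots.toFinset
  have hxR : x ∈ R := by simp [R, hp0, hx0]
  set m := R.max' ⟨x, hxR⟩
  have hm0 : p.eval m = 0 := by
    have := R.max'_mem ⟨x, hxR⟩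
    simpa [R, hp0] using this
  have hlm : l < m := (ht.trans_le hx.1).trans_le (R.le_max' x hxR)
  have hpos : ∀ s, m < s → 0 < p.eval s := by
    intro s hs
    by_contra! hneg
    obtain ⟨y, hy, hy0⟩ := intermediate_value_Icc (le_max_left s B) p.continuous.continuousOn
      ⟨hneg, (hB (max s B) (le_max_right _ _)).le⟩
    have : y ≤ m := R.le_max' y (by simp [R, hp0]; exact hy0)
    linarith [hy.1]
  have hq : 0 ≤ q.eval m := by
    refine ge_of_tendsto (x := 𝓝[>] m) (f := fun s => q.eval s)
      ((q.continuous.tendsto m).mono_left nhdsWithin_le_nhds) ?_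
    filter_upwards [self_mem_nhdsWithin] with s hs
    exact h.nonneg_of_forall_pos hd hpos hs
  have := hpq m hlm
  linarith

end

/-! ### Stable polynomials, directional derivatives and the operators `1 - D_w`. -/

section

open Polynomial Filter Topology ComplexConjugate

variable {τ : Type*}

/-- The univariate polynomial `f (z + X w)`. -/
noncomputable def linePoly {K : Type*} [CommRing K] [Algebra ℝ K] (z : τ → K) (w : τ → ℝ)
    (f : MvPolynomial τ ℝ) : K[X] :=
  MvPolynomial.aeval (fun a => C (z a) + C (algebraMap ℝ K (w a)) * X) f

/-- The derivative in direction `w`. -/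
noncomputable def dirDeriv (w : τ → ℝ) :
    Derivation ℝ (MvPolynomial τ ℝ) (MvPolynomial τ ℝ) :=
  MvPolynomial.mkDerivation ℝ fun a => MvPolynomial.C (w a)

theorem aeval_linePoly {K A : Type*} [CommRing K] [Algebra ℝ K] [CommRing A] [Algebra ℝ A]
    [Algebra K A] [IsScalarTower ℝ K A] (z : τ → K) (w : τ → ℝ) (f : MvPolynomial τ ℝ) (s : A) :
    aeval s (linePoly z w f) =
      MvPolynomial.aeval (fun a => algebraMap K A (z a) + algebraMap ℝ A (w a) * s) f := by
  have : ((aeval s : K[X] →ₐ[K] A).restrictScalars ℝ).comp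
      (MvPolynomial.aeval (fun a => C (z a) + C (algebraMap ℝ K (w a)) * X)) =
      MvPolynomial.aeval (fun a => algebraMap K A (z a) + algebraMap ℝ A (w a) * s) := by
    ext a
    simp [← IsScalarTower.algebraMap_apply]
  exact DFunLike.congr_fun this f

theorem eval_linePoly {K : Type*} [CommRing K] [Algebra ℝ K] (z : τ → K) (w : τ → ℝ)
    (f : MvPolynomial τ ℝ) (s : K) :
    (linePoly z w f).eval s = MvPolynomial.aeval (fun a => z a + algebraMap ℝ K (w a) * s) f :=
  aeval_linePoly (A := K) z w f s

theorem derivative_linePoly {K : Type*} [CommRing K] [Algebra ℝ K] (z : τ → K) (w : τ → ℝ)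
    (f : MvPolynomial τ ℝ) :
    derivative (linePoly z w f) = linePoly z w (dirDeriv w f) := by
  induction f using MvPolynomial.induction_on with
  | C a => simp [linePoly, dirDeriv, IsScalarTower.algebraMap_apply ℝ K K[X]]
  | add p q hp hq =>
    simp only [linePoly, map_add] at hp hq ⊢
    rw [hp, hq]
  | mul_X p a hp =>
    simp only [linePoly, map_mul, Derivation.leibniz, smul_eq_mul, map_add, derivative_mul] at hp ⊢
    rw [hp]
    simp [dirDeriv, IsScalarTower.algebraMap_apply ℝ K K[X]]
    ring

theorem natDegree_linePoly_le (z w : τ → ℝ) (f : MvPolynomial τ ℝ) :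
    (linePoly z w f).natDegree ≤ f.totalDegree := by
  have := MvPolynomial.aeval_natDegree_le (m := f.totalDegree) (n := 1) f le_rfl
    (fun a => C (z a) + C (algebraMap ℝ ℝ (w a)) * X) fun a => by
      refine natDegree_add_le_of_degree_le (by simp) ?_
      exact (natDegree_C_mul_le _ _).trans (by simp)
  simpa only [mul_one] using! this

theorem dirDeriv_apply_eq_sum [Fintype τ] (w : τ → ℝ) (f : MvPolynomial τ ℝ) :
    dirDeriv w f = ∑ a, w a • MvPolynomial.pderiv a f := by
  classical
  induction f using MvPolynomial.induction_on with
  | C a => simp [dirDeriv]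
  | add p q hp hq => simp [hp, hq, Finset.sum_add_distrib]
  | mul_X p i hp =>
    simp only [Derivation.leibniz, hp, smul_add, Finset.sum_add_distrib, smul_eq_mul,
      Finset.mul_sum, mul_smul_comm]
    simp [dirDeriv, MvPolynomial.pderiv_X, Pi.single_apply, MvPolynomial.smul_eq_C_mul, mul_comm]

theorem dirDeriv_add (w w' : τ → ℝ) : dirDeriv (w + w') = dirDeriv w + dirDeriv w' :=
  MvPolynomial.derivation_ext fun i => by simp [dirDeriv]

theorem dirDeriv_smul (c : ℝ) (w : τ → ℝ) : dirDeriv (c • w) = c • dirDeriv w :=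
  MvPolynomial.derivation_ext fun i => by simp [dirDeriv, MvPolynomial.smul_eq_C_mul]

theorem dirDeriv_comm (w w' : τ → ℝ) (f : MvPolynomial τ ℝ) :
    dirDeriv w (dirDeriv w' f) = dirDeriv w' (dirDeriv w f) := by
  have : ⁅dirDeriv w, dirDeriv w'⁆ = 0 :=
    MvPolynomial.derivation_ext fun i => by simp [dirDeriv, Derivation.commutator_apply]
  have h := DFunLike.congr_fun this f
  rw [Derivation.commutator_apply] at h
  simpa [sub_eq_zero] using h

theorem totalDegree_pderiv_le (a : τ) (f : MvPolynomial τ ℝ) :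
    (MvPolynomial.pderiv a f).totalDegree ≤ f.totalDegree - 1 := by
  classical
  rw [MvPolynomial.totalDegree, Finset.sup_le_iff]
  intro m hm
  rw [MvPolynomial.mem_support_iff, MvPolynomial.coeff_pderiv] at hm
  have h1 := MvPolynomial.le_totalDegree (MvPolynomial.mem_support_iff.2 (left_ne_zero_of_mul hm))
  rw [Finsupp.sum_add_index' (by simp) (by simp), Finsupp.sum_single_index rfl] at h1
  omega

theorem totalDegree_dirDeriv_le [Fintype τ] (w : τ → ℝ) (f : MvPolynomial τ ℝ) :
    (dirDeriv w f).totalDegree ≤ f.totalDegree - 1 := by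
  rw [dirDeriv_apply_eq_sum]
  refine MvPolynomial.totalDegree_finsetSum_le fun a _ => ?_
  exact (MvPolynomial.totalDegree_smul_le _ _).trans (totalDegree_pderiv_le a f)

/-- The operator `1 - D_w`. -/
noncomputable def subDirDeriv (w : τ → ℝ) (f : MvPolynomial τ ℝ) : MvPolynomial τ ℝ :=
  f - dirDeriv w f

theorem subDirDeriv_comm (w w' : τ → ℝ) (f : MvPolynomial τ ℝ) :
    subDirDeriv w (subDirDeriv w' f) = subDirDeriv w' (subDirDeriv w f) := by
  simp only [subDirDeriv, map_sub, dirDeriv_comm w w' f]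
  abel

/-- Real stability of a polynomial of degree at most `N`, strict in the variable `o`, with positive
leading coefficients in the positive directions. -/
structure IsStable (o : τ) (N : ℕ) (f : MvPolynomial τ ℝ) : Prop where
  aeval_ne_zero : ∀ z : τ → ℂ, 0 < (z o).im → (∀ a, 0 ≤ (z a).im) → MvPolynomial.aeval z f ≠ 0
  totalDegree_le : f.totalDegree ≤ N
  coeff_pos : ∀ z u : τ → ℝ, (∀ a, 0 ≤ u a) → 0 < u o → 0 < (linePoly z u f).coeff N

namespace IsStable

variable {o : τ} {N : ℕ} {f : MvPolynomial τ ℝ}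

/-- The quotient is the logarithmic derivative at `0` of `s ↦ f (z + s w)`, that is `∑ 1 / (0 - ρ)`
over its roots, all of which lie in the open lower half plane. -/
theorem im_div_aux (hf : IsStable o N f) {w : τ → ℝ} (hw : ∀ a, 0 ≤ w a) {z : τ → ℂ}
    (ho : 0 < (z o).im) (hz : ∀ a, 0 ≤ (z a).im) :
    (MvPolynomial.aeval z (dirDeriv w f) / MvPolynomial.aeval z f).im ≤ 0 ∧
      MvPolynomial.aeval z (dirDeriv w f) / MvPolynomial.aeval z f ≠ 1 := by
  set g : ℂ[X] := linePoly z w f with hg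
  have hne : ∀ s : ℂ, 0 ≤ s.im → g.eval s ≠ 0 := by
    intro s hs
    rw [hg, eval_linePoly]
    refine hf.aeval_ne_zero _ ?_ fun a => ?_
    · simpa using add_pos_of_pos_of_nonneg ho (mul_nonneg (hw o) hs)
    · simpa using add_nonneg (hz a) (mul_nonneg (hw a) hs)
  have h0 : MvPolynomial.aeval z f = g.eval 0 := by simp [hg, eval_linePoly]
  have h1 : MvPolynomial.aeval z (dirDeriv w f) = (derivative g).eval 0 := by
    simp [hg, derivative_linePoly, eval_linePoly]
  rw [h0, h1, (IsAlgClosed.splits g).eval_derivative_div_eval_of_ne_zero (hne 0 le_rfl)]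
  have hg0 : g ≠ 0 := by rintro h; exact hne 0 le_rfl (by simp [h])
  -- The dichotomy, rather than `≤ 0` alone, is what excludes the value `1`.
  have key : ∀ m : Multiset ℂ, (∀ ρ ∈ m, ρ.im < 0) →
      (m.map fun ρ => 1 / (0 - ρ)).sum.im < 0 ∨ (m.map fun ρ => 1 / (0 - ρ)).sum = 0 := by
    intro m
    induction m using Multiset.induction with
    | empty => simp
    | cons ρ m ih =>
      intro hm
      left
      have hρ : ρ.im < 0 := hm ρ (Multiset.mem_cons_self _ _)
      have h2 : (1 / (0 - ρ)).im < 0 := by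
        have : 0 < Complex.normSq (0 - ρ) := Complex.normSq_pos.2 fun h => by
          have := congrArg Complex.im h
          simp at this; exact hρ.ne this
        rw [one_div, Complex.inv_im]
        exact div_neg_of_neg_of_pos (by simpa using hρ) this
      rw [Multiset.map_cons, Multiset.sum_cons, Complex.add_im]
      rcases ih fun x hx => hm x (Multiset.mem_cons_of_mem hx) with h3 | h3
      · exact add_neg h2 h3
      · rw [h3]; simpa using h2
  rcases key g.roots fun ρ hρ => by
    by_contra! hh
    exact hne ρ hh (mem_roots'.1 hρ).2 with h | h
  · exact ⟨h.le, fun h' => by rw [h'] at h; simp at h⟩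
  · rw [h]; simp

/-- A zero of `f - D_w f` would make `D_w f / f` equal to `1`. The coefficient of degree `N` along a
line is unchanged because `D_w` lowers the degree. -/
theorem subDirDeriv [Fintype τ] (hf : IsStable o N f) (hN : 0 < N) {w : τ → ℝ}
    (hw : ∀ a, 0 ≤ w a) : IsStable o N (subDirDeriv w f) where
  aeval_ne_zero z ho hz h := by
    have h1 := (hf.im_div_aux hw ho hz).2
    rw [_root_.subDirDeriv, map_sub, sub_eq_zero] at h
    exact h1 (by rw [← h, div_self (hf.aeval_ne_zero z ho hz)])
  totalDegree_le := by
    refine (MvPolynomial.totalDegree_sub _ _).trans (max_le hf.totalDegree_le ?_)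
    exact (totalDegree_dirDeriv_le w f).trans ((Nat.sub_le _ _).trans hf.totalDegree_le)
  coeff_pos z u hu huo := by
    have h1 : (linePoly z u (dirDeriv w f)).coeff N = 0 := by
      refine coeff_eq_zero_of_natDegree_lt ?_
      have := natDegree_linePoly_le z u (dirDeriv w f)
      have := totalDegree_dirDeriv_le w f
      have := hf.totalDegree_le
      omega
    have h2 : linePoly z u (_root_.subDirDeriv w f) =
      linePoly z u f - linePoly z u (dirDeriv w f) := map_sub _ _ _
    rw [h2, coeff_sub, h1, sub_zero]
    exact hf.coeff_pos z u hu huo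

/-- All coordinates are pushed up by `iη` and `η → 0`. The product form survives at boundary points
where `f` vanishes, so directions with `u o = 0` can be treated later. -/
theorem im_mul_conj_nonpos (hf : IsStable o N f) {w : τ → ℝ} (hw : ∀ a, 0 ≤ w a) {z : τ → ℂ}
    (hz : ∀ a, 0 ≤ (z a).im) :
    (MvPolynomial.aeval z (dirDeriv w f) * conj (MvPolynomial.aeval z f)).im ≤ 0 := by
  have ht : Tendsto (fun η : ℝ =>
      ((linePoly z 1 (dirDeriv w f)).eval ((η : ℂ) * Complex.I) *
        conj ((linePoly z 1 f).eval ((η : ℂ) * Complex.I))).im) (𝓝[>] 0)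
      (𝓝 (((linePoly z 1 (dirDeriv w f)).eval (((0 : ℝ) : ℂ) * Complex.I) *
        conj ((linePoly z 1 f).eval (((0 : ℝ) : ℂ) * Complex.I))).im)) := by
    refine (Continuous.tendsto ?_ 0).mono_left nhdsWithin_le_nhds
    have h1 : ∀ g : ℂ[X], Continuous fun η : ℝ => g.eval ((η : ℂ) * Complex.I) := fun g =>
      g.continuous.comp (by fun_prop)
    exact Complex.continuous_im.comp ((h1 _).mul (Complex.continuous_conj.comp (h1 _)))
  have h0 : (((linePoly z 1 (dirDeriv w f)).eval (((0 : ℝ) : ℂ) * Complex.I) *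
        conj ((linePoly z 1 f).eval (((0 : ℝ) : ℂ) * Complex.I))).im) ≤ 0 := by
    refine le_of_tendsto ht ?_
    filter_upwards [self_mem_nhdsWithin] with η hη
    have hη : 0 < η := hη
    have hpos : ∀ a, 0 < (z a + algebraMap ℝ ℂ ((1 : τ → ℝ) a) * (η * Complex.I)).im := fun a => by
      simpa using add_pos_of_nonneg_of_pos (hz a) hη
    rw [eval_linePoly, eval_linePoly]
    have h1 := (hf.im_div_aux hw (hpos o) fun a => (hpos a).le).1
    have h2 := hf.aeval_ne_zero _ (hpos o) fun a => (hpos a).le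
    set q := MvPolynomial.aeval (fun a => z a + algebraMap ℝ ℂ ((1 : τ → ℝ) a) * (η * Complex.I))
      (dirDeriv w f)
    set p := MvPolynomial.aeval (fun a => z a + algebraMap ℝ ℂ ((1 : τ → ℝ) a) * (η * Complex.I)) f
    have h3 : q * conj p = ((Complex.normSq p : ℝ) : ℂ) * (q / p) := by
      rw [← Complex.mul_conj]; field_simp
    rw [h3, Complex.im_ofReal_mul]
    exact mul_nonpos_of_nonneg_of_nonpos (Complex.normSq_nonneg _) h1
  simpa [eval_linePoly] using h0

theorem isAntiPick_linePoly (hf : IsStable o N f) {w : τ → ℝ} (hw : ∀ a, 0 ≤ w a) (z : τ → ℝ)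
    {u : τ → ℝ} (hu : ∀ a, 0 ≤ u a) :
    IsAntiPick (linePoly z u f) (linePoly z u (dirDeriv w f)) := fun s hs => by
  rw [aeval_linePoly, aeval_linePoly]
  exact hf.im_mul_conj_nonpos hw fun a => by simpa using mul_nonneg (hu a) hs.le

theorem splits_linePoly (hf : IsStable o N f) (z : τ → ℝ) {u : τ → ℝ} (hu : ∀ a, 0 ≤ u a)
    (huo : 0 < u o) : (linePoly z u f).Splits :=
  splits_of_forall_aeval_ne_zero fun s hs => by
    rw [aeval_linePoly]
    exact hf.aeval_ne_zero _ (by simpa using mul_pos huo hs)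
      fun a => by simpa using mul_nonneg (hu a) hs.le

theorem natDegree_linePoly (hf : IsStable o N f) (z : τ → ℝ) {u : τ → ℝ} (hu : ∀ a, 0 ≤ u a)
    (huo : 0 < u o) : (linePoly z u f).natDegree = N :=
  le_antisymm ((natDegree_linePoly_le z u f).trans hf.totalDegree_le)
    (le_natDegree_of_ne_zero (hf.coeff_pos z u hu huo).ne')

theorem leadingCoeff_linePoly_pos (hf : IsStable o N f) (z : τ → ℝ) {u : τ → ℝ}
    (hu : ∀ a, 0 ≤ u a) (huo : 0 < u o) : 0 < (linePoly z u f).leadingCoeff := by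
  rw [leadingCoeff, hf.natDegree_linePoly z hu huo]
  exact hf.coeff_pos z u hu huo

theorem degree_linePoly_dirDeriv_lt [Fintype τ] (hf : IsStable o N f) (hN : 0 < N) (w z : τ → ℝ)
    {u : τ → ℝ} (hu : ∀ a, 0 ≤ u a) (huo : 0 < u o) :
    (linePoly z u (dirDeriv w f)).degree < (linePoly z u f).degree := by
  refine degree_lt_degree ?_
  rw [hf.natDegree_linePoly z hu huo]
  have := natDegree_linePoly_le z u (dirDeriv w f)
  have := totalDegree_dirDeriv_le w f
  have := hf.totalDegree_le
  omega

end IsStable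

end

/-! ### The barrier argument and the method of interlacing polynomials. -/

section

open Polynomial Filter Topology ComplexConjugate

variable {τ : Type*}

theorem eval_linePoly_real (z w : τ → ℝ) (f : MvPolynomial τ ℝ) (s : ℝ) :
    (linePoly z w f).eval s = MvPolynomial.eval (fun a => z a + w a * s) f := by
  rw [eval_linePoly, MvPolynomial.aeval_eq_eval]
  rfl

/-- The point `z` lies above the zeros of `f`. -/
def IsAbove (f : MvPolynomial τ ℝ) (z : τ → ℝ) : Prop :=
  ∀ y : τ → ℝ, z ≤ y → 0 < MvPolynomial.eval y f

/-- The logarithmic derivative of `f` in direction `w`. -/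
noncomputable def barrier (w : τ → ℝ) (f : MvPolynomial τ ℝ) (z : τ → ℝ) : ℝ :=
  MvPolynomial.eval z (dirDeriv w f) / MvPolynomial.eval z f

theorem IsAbove.mono {f : MvPolynomial τ ℝ} {z y : τ → ℝ} (h : IsAbove f z) (hzy : z ≤ y) :
    IsAbove f y := fun x hx => h x (hzy.trans hx)

namespace IsStable

variable {o : τ} {N : ℕ} {f : MvPolynomial τ ℝ}

theorem barrier_anti (hf : IsStable o N f) {w : τ → ℝ} (hw : ∀ a, 0 ≤ w a) {z y : τ → ℝ}
    (hz : IsAbove f z) (hzy : z ≤ y) : barrier w f y ≤ barrier w f z := by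
  have hu : ∀ a, 0 ≤ (y - z) a := fun a => sub_nonneg.2 (hzy a)
  have h := (hf.isAntiPick_linePoly hw z hu).antitoneOn (convex_Ici (0 : ℝ)) fun t ht => by
    rw [eval_linePoly_real]
    exact (hz _ fun a => le_add_of_nonneg_right (mul_nonneg (hu a) ht)).ne'
  have h1 := h (Set.mem_Ici.2 le_rfl) (Set.mem_Ici.2 zero_le_one) zero_le_one
  simpa [eval_linePoly_real, barrier] using h1

theorem barrier_sub_le_of_pos [Fintype τ] (hf : IsStable o N f) (hN : 0 < N) {w u : τ → ℝ}
    (hw : ∀ a, 0 ≤ w a) (hu : ∀ a, 0 ≤ u a) (huo : 0 < u o) {z : τ → ℝ} (hz : IsAbove f z)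
    {d : ℝ} (hd : 0 ≤ d) :
    barrier w f (z + d • u) - barrier w f z ≤
      d * ((MvPolynomial.eval (z + d • u) (dirDeriv u (dirDeriv w f)) *
        MvPolynomial.eval (z + d • u) f - MvPolynomial.eval (z + d • u) (dirDeriv w f) *
        MvPolynomial.eval (z + d • u) (dirDeriv u f)) / MvPolynomial.eval (z + d • u) f ^ 2) := by
  have h := (hf.isAntiPick_linePoly hw z hu).sub_le_mul_wronskian (hf.splits_linePoly z hu huo)
    (hf.degree_linePoly_dirDeriv_lt hN w z hu huo) hd fun t ht => by
    rw [eval_linePoly_real]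
    exact (hz _ fun a => le_add_of_nonneg_right (mul_nonneg (hu a) ht)).ne'
  have e : (fun a => z a + u a * d) = z + d • u := by
    ext a; simp [mul_comm]
  simp only [derivative_linePoly, eval_linePoly_real, e, mul_zero, add_zero, sub_zero] at h
  exact h

/-- Convexity of the barrier function in positive directions. -/
theorem barrier_sub_le [Fintype τ] (hf : IsStable o N f) (hN : 0 < N) {w u : τ → ℝ}
    (hw : ∀ a, 0 ≤ w a) (hu : ∀ a, 0 ≤ u a) {z : τ → ℝ} (hz : IsAbove f z)
    {d : ℝ} (hd : 0 ≤ d) :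
    barrier w f (z + d • u) - barrier w f z ≤
      d * ((MvPolynomial.eval (z + d • u) (dirDeriv u (dirDeriv w f)) *
        MvPolynomial.eval (z + d • u) f - MvPolynomial.eval (z + d • u) (dirDeriv w f) *
        MvPolynomial.eval (z + d • u) (dirDeriv u f)) / MvPolynomial.eval (z + d • u) f ^ 2) := by
  -- The direction `u` may have `u o = 0`, where real-rootedness along the line is not available; it
  -- is replaced by `u + η • 1`, and `η → 0` from the right.
  have hcont : ∀ g : MvPolynomial τ ℝ, Continuous fun η : ℝ =>
      MvPolynomial.eval (z + d • (u + η • (1 : τ → ℝ))) g := fun g =>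
    (MvPolynomial.continuous_eval g).comp (by fun_prop)
  have hne : ∀ η : ℝ, 0 ≤ η → MvPolynomial.eval (z + d • (u + η • (1 : τ → ℝ))) f ≠ 0 :=
    fun η hη => (hz _ <| le_add_of_nonneg_right fun a =>
      mul_nonneg hd (add_nonneg (hu a) (by simpa using hη))).ne'
  have hpos : ∀ η : ℝ, 0 < η → ∀ a, 0 < (u + η • (1 : τ → ℝ)) a := fun η hη a => by
    simpa using add_pos_of_nonneg_of_pos (hu a) hη
  have hc2 : ∀ g : MvPolynomial τ ℝ, Continuous fun η : ℝ =>
      MvPolynomial.eval (z + d • (u + η • (1 : τ → ℝ))) (dirDeriv (u + η • (1 : τ → ℝ)) g) := by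
    intro g
    have : ∀ η : ℝ, MvPolynomial.eval (z + d • (u + η • (1 : τ → ℝ)))
        (dirDeriv (u + η • (1 : τ → ℝ)) g) =
        MvPolynomial.eval (z + d • (u + η • (1 : τ → ℝ))) (dirDeriv u g) +
        η * MvPolynomial.eval (z + d • (u + η • (1 : τ → ℝ))) (dirDeriv 1 g) := fun η => by
      rw [dirDeriv_add, dirDeriv_smul, Derivation.add_apply, Derivation.smul_apply, map_add,
        MvPolynomial.smul_eval]
    simp_rw [this]
    exact (hcont _).add (continuous_id.mul (hcont _))
  have hl : Tendsto (fun η : ℝ => barrier w f (z + d • (u + η • (1 : τ → ℝ))) - barrier w f z)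
      (𝓝[>] 0) (𝓝 (barrier w f (z + d • (u + (0 : ℝ) • (1 : τ → ℝ))) - barrier w f z)) := by
    refine (Tendsto.sub_const ?_ _).mono_left nhdsWithin_le_nhds
    exact ((hcont _).continuousAt.div (hcont _).continuousAt (hne 0 le_rfl))
  have hr : Tendsto (fun η : ℝ => d * ((MvPolynomial.eval (z + d • (u + η • (1 : τ → ℝ)))
        (dirDeriv (u + η • (1 : τ → ℝ)) (dirDeriv w f)) *
        MvPolynomial.eval (z + d • (u + η • (1 : τ → ℝ))) f -
        MvPolynomial.eval (z + d • (u + η • (1 : τ → ℝ))) (dirDeriv w f) *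
        MvPolynomial.eval (z + d • (u + η • (1 : τ → ℝ))) (dirDeriv (u + η • (1 : τ → ℝ)) f)) /
        MvPolynomial.eval (z + d • (u + η • (1 : τ → ℝ))) f ^ 2)) (𝓝[>] 0) (𝓝 (d *
        ((MvPolynomial.eval (z + d • (u + (0 : ℝ) • (1 : τ → ℝ)))
        (dirDeriv (u + (0 : ℝ) • (1 : τ → ℝ)) (dirDeriv w f)) *
        MvPolynomial.eval (z + d • (u + (0 : ℝ) • (1 : τ → ℝ))) f -
        MvPolynomial.eval (z + d • (u + (0 : ℝ) • (1 : τ → ℝ))) (dirDeriv w f) *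
        MvPolynomial.eval (z + d • (u + (0 : ℝ) • (1 : τ → ℝ)))
          (dirDeriv (u + (0 : ℝ) • (1 : τ → ℝ)) f)) /
        MvPolynomial.eval (z + d • (u + (0 : ℝ) • (1 : τ → ℝ))) f ^ 2))) := by
    refine (Tendsto.const_mul d ?_).mono_left nhdsWithin_le_nhds
    exact (((hc2 _).mul (hcont _)).sub ((hcont _).mul (hc2 _))).continuousAt.div
      ((hcont _).pow 2).continuousAt (pow_ne_zero 2 (hne 0 le_rfl))
  have := le_of_tendsto_of_tendsto hl hr (by
    filter_upwards [self_mem_nhdsWithin] with η hη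
    exact hf.barrier_sub_le_of_pos hN hw (fun a => (hpos η hη a).le) (hpos η hη o) hz hd)
  simpa only [zero_smul, add_zero] using this

theorem isAbove_subDirDeriv (hf : IsStable o N f) {w : τ → ℝ} (hw : ∀ a, 0 ≤ w a) {z : τ → ℝ}
    (hz : IsAbove f z) (h : barrier w f z < 1) : IsAbove (_root_.subDirDeriv w f) z := by
  intro y hy
  have h1 := (hf.barrier_anti hw hz hy).trans_lt h
  rw [barrier, div_lt_one (hz y hy)] at h1
  simpa [_root_.subDirDeriv] using h1

/-- Write `Φ` for the barrier in direction `w'` and `Φ_w` for that in direction `w`. The new barrier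
is `Φ - ∂_w Φ / (1 - Φ_w)`, with `∂_w Φ ≤ 0` and `1 / (1 - Φ_w) ≤ d`. Its excess over `Φ` at `z + d
• w` is at most `-d ∂_w Φ`, which by convexity the shift from `z` has already gained. -/
theorem barrier_subDirDeriv_le [Fintype τ] (hf : IsStable o N f) (hN : 0 < N) {w w' : τ → ℝ}
    (hw : ∀ a, 0 ≤ w a) (hw' : ∀ a, 0 ≤ w' a) {z : τ → ℝ} (hz : IsAbove f z) {d : ℝ}
    (hd : 0 < d) (h : barrier w f z ≤ 1 - 1 / d) :
    barrier w' (_root_.subDirDeriv w f) (z + d • w) ≤ barrier w' f z := by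
  have hzy : z ≤ z + d • w := le_add_of_nonneg_right fun a => mul_nonneg hd.le (hw a)
  have hconv := hf.barrier_sub_le hN hw' hw hz hd.le
  have hanti := (hf.barrier_anti hw hz hzy).trans h
  have hmono := (hf.isAntiPick_linePoly hw' (z + d • w) hw).wronskian_nonpos 0
  simp only [derivative_linePoly, eval_linePoly_real, mul_zero, add_zero] at hmono
  have hF : 0 < MvPolynomial.eval (z + d • w) f := hz _ hzy
  refine le_trans ?_ (sub_le_comm.1 hconv)
  simp only [barrier, _root_.subDirDeriv, map_sub] at hanti ⊢
  rw [dirDeriv_comm w' w]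
  set F := MvPolynomial.eval (z + d • w) f
  set a := MvPolynomial.eval (z + d • w) (dirDeriv w' f)
  set b := MvPolynomial.eval (z + d • w) (dirDeriv w f)
  set c := MvPolynomial.eval (z + d • w) (dirDeriv w (dirDeriv w' f))
  have hd' : 1 / d ≤ (F - b) / F := by
    rw [sub_div, div_self hF.ne']; linarith
  have hFb : 0 < F - b := by
    have : 0 < (F - b) / F := (one_div_pos.2 hd).trans_le hd'
    exact (div_pos_iff_of_pos_right hF).1 this
  have h2 : F ≤ d * (F - b) := by
    rw [div_le_div_iff₀ hd hF] at hd'; linarith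
  have e : (a - c) / (F - b) - (a / F - d * ((c * F - a * b) / F ^ 2)) =
      (c * F - a * b) * (d * (F - b) - F) / (F ^ 2 * (F - b)) := by
    field_simp; ring
  have : (c * F - a * b) * (d * (F - b) - F) / (F ^ 2 * (F - b)) ≤ 0 :=
    div_nonpos_of_nonpos_of_nonneg
      (mul_nonpos_of_nonpos_of_nonneg hmono (by linarith)) (by positivity)
  linarith

/-- The operators `1 - D_w`, for `w` in the list `l`. -/
theorem foldr_subDirDeriv [Fintype τ] (hf : IsStable o N f) (hN : 0 < N) {l : List (τ → ℝ)}
    (hl : ∀ w ∈ l, ∀ a, 0 ≤ w a) : IsStable o N (l.foldr _root_.subDirDeriv f) := by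
  induction l with
  | nil => exact hf
  | cons w l ih =>
    exact (ih fun x hx => hl x (List.mem_cons_of_mem _ hx)).subDirDeriv hN
      (hl w List.mem_cons_self)

/-- The multivariate barrier argument. -/
theorem isAbove_foldr [Fintype τ] (hf : IsStable o N f) (hN : 0 < N) {z : τ → ℝ}
    (hz : IsAbove f z) {d : ℝ} (hd : 0 < d) {l : List (τ → ℝ)} (hl : ∀ w ∈ l, ∀ a, 0 ≤ w a)
    (h : ∀ w ∈ l, barrier w f z ≤ 1 - 1 / d) :
    IsAbove (l.foldr _root_.subDirDeriv f) (z + d • l.sum) := by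
  have key : ∀ l : List (τ → ℝ), (∀ w ∈ l, ∀ a, 0 ≤ w a) → (∀ w ∈ l, barrier w f z ≤ 1 - 1 / d) →
      IsAbove (l.foldr _root_.subDirDeriv f) (z + d • l.sum) ∧
      ∀ w' : τ → ℝ, (∀ a, 0 ≤ w' a) →
        barrier w' (l.foldr _root_.subDirDeriv f) (z + d • l.sum) ≤ barrier w' f z := by
    intro l
    induction l with
    | nil => intro _ _; simpa using hz
    | cons w l ih =>
      intro hl h
      obtain ⟨h1, h2⟩ := ih (fun x hx => hl x (List.mem_cons_of_mem _ hx))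
        (fun x hx => h x (List.mem_cons_of_mem _ hx))
      have hs := hf.foldr_subDirDeriv hN (fun x hx => hl x (List.mem_cons_of_mem _ hx))
      have hw := hl w List.mem_cons_self
      have hb := (h2 w hw).trans (h w List.mem_cons_self)
      have e : z + d • (w :: l).sum = z + d • l.sum + d • w := by
        rw [List.sum_cons, smul_add]; abel
      rw [e, List.foldr_cons]
      refine ⟨(hs.isAbove_subDirDeriv hw h1 (hb.trans_lt ?_)).mono
        (le_add_of_nonneg_right fun a => mul_nonneg hd.le (hw a)), fun w' hw' =>
        (hs.barrier_subDirDeriv_le hN hw hw' h1 hd hb).trans (h2 w' hw')⟩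
      have := one_div_pos.2 hd
      linarith
  exact (key l hl h).1

/-- One step of the method of interlacing polynomials. -/
theorem exists_pos_of_sum_smul [Fintype τ] {κ : Type*} [Fintype κ] (hf : IsStable o N f)
    (hN : 0 < N) {w : κ → τ → ℝ} (hw : ∀ k a, 0 ≤ w k a) {p : κ → ℝ} (hp : ∀ k, 0 ≤ p k)
    (hp1 : ∑ k, p k = 1) {z u : τ → ℝ} (hu : ∀ a, 0 ≤ u a) (huo : 0 < u o) {l : ℝ}
    (h : ∀ t, l < t →
      0 < MvPolynomial.eval (z + t • u) (_root_.subDirDeriv (∑ k, p k • w k) f)) :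
    ∃ k, ∀ t, l < t → 0 < MvPolynomial.eval (z + t • u) (_root_.subDirDeriv (w k) f) := by
  have e : ∀ t : ℝ, (fun a => z a + u a * t) = z + t • u := fun t => by
    ext a; simp [mul_comm]
  have hW : ∀ a, 0 ≤ (∑ k, p k • w k) a := fun a => by
    rw [Finset.sum_apply]
    exact Finset.sum_nonneg fun k _ => mul_nonneg (hp k) (hw k a)
  -- Positivity of the average passes to `f` itself, so all quotients below share a denominator
  -- without zeros beyond `l`.
  have hpos : ∀ t, l < t → 0 < (linePoly z u f).eval t := fun t ht =>
    (hf.isAntiPick_linePoly hW z hu).pos_of_sub_pos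
      (hf.degree_linePoly_dirDeriv_lt hN _ z hu huo) (hf.leadingCoeff_linePoly_pos z hu huo)
      (fun s hs => by
        rw [eval_linePoly_real, eval_linePoly_real, e]
        simpa [_root_.subDirDeriv] using h s hs) ht
  have hsum : ∀ t : ℝ, MvPolynomial.eval (z + t • u) (_root_.subDirDeriv (∑ k, p k • w k) f) =
      ∑ k, p k * MvPolynomial.eval (z + t • u) (_root_.subDirDeriv (w k) f) := by
    intro (t : ℝ)
    have hD : dirDeriv (∑ k, p k • w k) f = ∑ k, p k • dirDeriv (w k) f := by
      simp only [dirDeriv_apply_eq_sum, Finset.sum_apply, Finset.sum_smul, Finset.smul_sum]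
      rw [Finset.sum_comm]
      simp [smul_smul]
    simp only [_root_.subDirDeriv, hD, map_sub, map_sum, MvPolynomial.smul_eval, mul_sub,
      Finset.sum_sub_distrib, ← Finset.sum_mul, hp1, one_mul]
  have hex : ∀ t : ℝ, l < t → ∃ k, 0 < MvPolynomial.eval (z + t • u) (_root_.subDirDeriv (w k) f) := by
    intro t ht
    by_contra! hneg
    have := h t ht
    rw [hsum] at this
    exact this.not_ge (Finset.sum_nonpos fun k _ => mul_nonpos_of_nonneg_of_nonpos (hp k) (hneg k))
  -- Each `(f - D_{w k} f) / f` increases beyond `l`, so positivity at one point persists to its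
  -- right. If every `k` failed somewhere, then at the least failure point some `k` would be
  -- positive by averaging, and would stay positive at its own failure point.
  have hmono : ∀ (k : κ) (s t : ℝ), l < s → s ≤ t →
      0 < MvPolynomial.eval (z + s • u) (_root_.subDirDeriv (w k) f) →
      0 < MvPolynomial.eval (z + t • u) (_root_.subDirDeriv (w k) f) := by
    intro k s t hs hst hk
    have h1 := (hf.isAntiPick_linePoly (hw k) z hu).antitoneOn (convex_Ioi l)
      (fun t ht => (hpos t ht).ne') hs (hs.trans_le hst) hst
    have h2 := hpos s hs
    have h3 := hpos t (hs.trans_le hst)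
    simp only [eval_linePoly_real, e] at h1 h2 h3
    simp only [_root_.subDirDeriv, map_sub, sub_pos] at hk ⊢
    rw [← div_lt_one h2] at hk
    exact (div_lt_one h3).1 (h1.trans_lt hk)
  by_contra! hcon
  choose t ht hneg using hcon
  have : Nonempty κ := by
    by_contra hempty
    rw [not_nonempty_iff] at hempty
    simp at hp1
  obtain ⟨k, hk⟩ := hex (Finset.univ.inf' Finset.univ_nonempty t)
    ((Finset.lt_inf'_iff _).2 fun k _ => ht k)
  exact (hneg k).not_gt (hmono k _ _ ((Finset.lt_inf'_iff _).2 fun k _ => ht k)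
    (Finset.inf'_le _ (Finset.mem_univ k)) hk)

end IsStable

theorem foldr_subDirDeriv_subDirDeriv (l : List (τ → ℝ)) (w : τ → ℝ) (f : MvPolynomial τ ℝ) :
    l.foldr subDirDeriv (subDirDeriv w f) = subDirDeriv w (l.foldr subDirDeriv f) := by
  induction l with
  | nil => rfl
  | cons v l ih => rw [List.foldr_cons, ih, subDirDeriv_comm, List.foldr_cons]

namespace IsStable

variable {o : τ} {N : ℕ} {f : MvPolynomial τ ℝ}

/-- The method of interlacing polynomials. -/
theorem exists_choice_foldr [Fintype τ] {κ ι : Type*} [Fintype κ] (hf : IsStable o N f)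
    (hN : 0 < N) {w : ι → κ → τ → ℝ} (hw : ∀ i k a, 0 ≤ w i k a) {p : κ → ℝ} (hp : ∀ k, 0 ≤ p k)
    (hp1 : ∑ k, p k = 1) {z u : τ → ℝ} (hu : ∀ a, 0 ≤ u a) (huo : 0 < u o) {b : ℝ} {l : List ι}
    (hl : l.Nodup)
    (h : ∀ t, b < t → 0 < MvPolynomial.eval (z + t • u)
      ((l.map fun i => ∑ k, p k • w i k).foldr _root_.subDirDeriv f)) :
    ∃ c : ι → κ, ∀ t, b < t → 0 < MvPolynomial.eval (z + t • u)
      ((l.map fun i => w i (c i)).foldr _root_.subDirDeriv f) := by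
  classical
  induction l generalizing f with
  | nil =>
    have : Nonempty κ := by
      by_contra hempty
      rw [not_nonempty_iff] at hempty
      simp at hp1
    exact ⟨fun _ => Classical.arbitrary κ, by simpa using h⟩
  | cons i l ih =>
    obtain ⟨hil, hl⟩ := List.nodup_cons.1 hl
    have hs : IsStable o N ((l.map fun i => ∑ k, p k • w i k).foldr _root_.subDirDeriv f) := by
      refine hf.foldr_subDirDeriv hN fun v hv a => ?_
      obtain ⟨j, -, rfl⟩ := List.mem_map.1 hv
      rw [Finset.sum_apply]
      exact Finset.sum_nonneg fun k _ => mul_nonneg (hp k) (hw j k a)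
    obtain ⟨k, hk⟩ := hs.exists_pos_of_sum_smul hN (hw i) hp hp1 hu huo h
    -- The operators commute, so the operator just fixed is absorbed into the base polynomial before
    -- recursing.
    obtain ⟨c, hcp⟩ := ih (hf.subDirDeriv hN (hw i k)) hl fun t ht => by
      rw [foldr_subDirDeriv_subDirDeriv]
      exact hk t ht
    refine ⟨Function.update c i k, fun t ht => ?_⟩
    have e : (l.map fun j => w j (Function.update c i k j)) = l.map fun j => w j (c j) :=
      List.map_congr_left fun j hj => by
        rw [Function.update_of_ne]
        rintro rfl
        exact hil hj
    rw [List.map_cons, e, Function.update_self, List.foldr_cons, ← foldr_subDirDeriv_subDirDeriv]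
    exact hcp t ht

end IsStable

end

/-! ### The determinantal polynomial of a Hermitian pencil. -/

section

open Polynomial Filter Topology ComplexConjugate
open scoped ComplexOrder

theorem MvPolynomial.exists_eq_map_add_map {τ : Type*} (f : MvPolynomial τ ℂ) :
    ∃ f₀ f₁ : MvPolynomial τ ℝ, f = MvPolynomial.map Complex.ofRealHom f₀ +
      MvPolynomial.C Complex.I * MvPolynomial.map Complex.ofRealHom f₁ := by
  induction f using MvPolynomial.induction_on with
  | C a =>
    refine ⟨MvPolynomial.C a.re, MvPolynomial.C a.im, ?_⟩
    rw [MvPolynomial.map_C, MvPolynomial.map_C, ← MvPolynomial.C_mul, ← MvPolynomial.C_add]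
    congr 1
    rw [mul_comm]
    exact (Complex.re_add_im a).symm
  | add p q hp hq =>
    obtain ⟨p₀, p₁, rfl⟩ := hp
    obtain ⟨q₀, q₁, rfl⟩ := hq
    exact ⟨p₀ + q₀, p₁ + q₁, by simp only [map_add]; ring⟩
  | mul_X p a hp =>
    obtain ⟨p₀, p₁, rfl⟩ := hp
    exact ⟨p₀ * MvPolynomial.X a, p₁ * MvPolynomial.X a, by
      simp only [map_mul, MvPolynomial.map_X]; ring⟩

theorem MvPolynomial.eval_ofReal_map {τ : Type*} (f : MvPolynomial τ ℝ) (x : τ → ℝ) :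
    MvPolynomial.eval (fun a => (x a : ℂ)) (MvPolynomial.map Complex.ofRealHom f) =
      ((MvPolynomial.eval x f : ℝ) : ℂ) := by
  rw [MvPolynomial.eval_map]
  exact (MvPolynomial.eval₂_comp_left Complex.ofRealHom (RingHom.id ℝ) x f).symm

theorem MvPolynomial.exists_eq_map_of_forall_im_eq_zero {τ : Type*} (f : MvPolynomial τ ℂ)
    (h : ∀ x : τ → ℝ, (MvPolynomial.eval (fun a => (x a : ℂ)) f).im = 0) :
    ∃ f₀ : MvPolynomial τ ℝ, f = MvPolynomial.map Complex.ofRealHom f₀ := by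
  obtain ⟨f₀, f₁, rfl⟩ := f.exists_eq_map_add_map
  refine ⟨f₀, ?_⟩
  have : f₁ = 0 := MvPolynomial.funext fun x => by
    have := h x
    rw [map_add, map_mul, MvPolynomial.eval_ofReal_map, MvPolynomial.eval_ofReal_map,
      MvPolynomial.eval_C] at this
    simpa using this
  simp [this]

theorem sum_norm_sq_pos {n : Type*} [Fintype n] {y : n → ℂ} (hy : y ≠ 0) : 0 < ∑ b, ‖y b‖ ^ 2 := by
  obtain ⟨b, hb⟩ := Function.ne_iff.1 hy
  exact Finset.sum_pos' (fun _ _ => by positivity) ⟨b, Finset.mem_univ _, by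
    have : 0 < ‖y b‖ := norm_pos_iff.2 hb
    positivity⟩

variable {σ n : Type*} [Fintype σ] [DecidableEq n]

/-- The matrix `z₀ + ∑ zₐ vₐ vₐ*`. -/
noncomputable def pencil (v : σ → n → ℂ) (z : Option σ → ℂ) : Matrix n n ℂ :=
  z none • (1 : Matrix n n ℂ) + ∑ a, z (some a) • Matrix.vecMulVec (v a) (star (v a))

theorem pencil_add_smul (v : σ → n → ℂ) (z u : Option σ → ℂ) (s : ℂ) :
    pencil v (z + s • u) = pencil v z + s • pencil v u := by
  simp only [pencil, Pi.add_apply, Pi.smul_apply, smul_eq_mul, add_smul, smul_add, mul_smul,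
    Finset.sum_add_distrib, Finset.smul_sum]
  abel

theorem isHermitian_pencil (v : σ → n → ℂ) (z : Option σ → ℝ) :
    (pencil v fun a => (z a : ℂ)).IsHermitian := by
  have hs : ∀ c : ℝ, IsSelfAdjoint (c : ℂ) := fun c => Complex.conj_ofReal c
  refine Matrix.IsHermitian.add (Matrix.isHermitian_one.smul (hs _)) ?_
  refine isSelfAdjoint_sum (R := Matrix n n ℂ) _ fun a _ => ?_
  refine Matrix.IsHermitian.smul ?_ (hs _)
  rw [Matrix.IsHermitian, Matrix.conjTranspose_vecMulVec, star_star]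

variable [Fintype n]

theorem star_dotProduct_pencil_mulVec (v : σ → n → ℂ) (z : Option σ → ℂ) (y : n → ℂ) :
    star y ⬝ᵥ (pencil v z).mulVec y =
      z none * ((∑ b, ‖y b‖ ^ 2 : ℝ) : ℂ) +
        ∑ a, z (some a) * ((‖star (v a) ⬝ᵥ y‖ ^ 2 : ℝ) : ℂ) := by
  have h1 : star y ⬝ᵥ y = ((∑ b, ‖y b‖ ^ 2 : ℝ) : ℂ) := by
    simp [dotProduct, Complex.conj_mul']
  have h2 : ∀ a, star y ⬝ᵥ (Matrix.vecMulVec (v a) (star (v a))).mulVec y =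
      ((‖star (v a) ⬝ᵥ y‖ ^ 2 : ℝ) : ℂ) := by
    intro a
    have h3 : star y ⬝ᵥ v a = star (star (v a) ⬝ᵥ y) := by
      rw [Matrix.star_dotProduct]
    rw [Matrix.vecMulVec_mulVec]
    simp only [dotProduct_smul, h3]
    simp [Complex.conj_mul']
  simp only [pencil, Matrix.add_mulVec, Matrix.sum_mulVec, Matrix.smul_mulVec, Matrix.one_mulVec,
    dotProduct_add, dotProduct_sum, dotProduct_smul, h1, h2, smul_eq_mul]

theorem posDef_pencil (v : σ → n → ℂ) (z : Option σ → ℝ)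
    (h : ∀ y : n → ℂ, y ≠ 0 →
      0 < z none * ∑ b, ‖y b‖ ^ 2 + ∑ a, z (some a) * ‖star (v a) ⬝ᵥ y‖ ^ 2) :
    (pencil v fun a => (z a : ℂ)).PosDef := by
  refine Matrix.posDef_iff_dotProduct_mulVec.2 ⟨isHermitian_pencil v z, fun y hy => ?_⟩
  rw [star_dotProduct_pencil_mulVec]
  exact_mod_cast h y hy

/-- The determinant has complex entries but takes real values at real points, the pencil being
Hermitian there; hence its coefficients are real. -/
theorem exists_pencilPoly (v : σ → n → ℂ) :
    ∃ P : MvPolynomial (Option σ) ℝ, P.totalDegree ≤ Fintype.card n ∧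
      ∀ z : Option σ → ℂ, MvPolynomial.aeval z P = (pencil v z).det := by
  set M : Matrix n n (MvPolynomial (Option σ) ℂ) := Matrix.of fun i j =>
    MvPolynomial.X none * MvPolynomial.C ((1 : Matrix n n ℂ) i j) +
      ∑ a, MvPolynomial.X (some a) * MvPolynomial.C (Matrix.vecMulVec (v a) (star (v a)) i j) with hM
  have heval : ∀ z : Option σ → ℂ, MvPolynomial.eval z M.det = (pencil v z).det := by
    intro z
    rw [RingHom.map_det]
    congr 1
    ext i j
    simp [hM, pencil, Matrix.sum_apply]
  have hdeg : M.det.totalDegree ≤ Fintype.card n := by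
    rw [Matrix.det_apply]
    refine MvPolynomial.totalDegree_finsetSum_le fun π _ => ?_
    rw [Units.smul_def, ← Int.cast_smul_eq_zsmul ℂ]
    refine (MvPolynomial.totalDegree_smul_le _ _).trans
      ((MvPolynomial.totalDegree_finsetProd _ _).trans ?_)
    refine (Finset.sum_le_card_nsmul _ _ 1 fun i _ => ?_).trans (by simp)
    have h1 : ∀ (a : Option σ) (c : ℂ),
        (MvPolynomial.X a * MvPolynomial.C c : MvPolynomial (Option σ) ℂ).totalDegree ≤ 1 :=
      fun a c => (MvPolynomial.totalDegree_mul _ _).trans (by simp)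
    exact (MvPolynomial.totalDegree_add _ _).trans (max_le (h1 _ _)
      (MvPolynomial.totalDegree_finsetSum_le fun a _ => h1 _ _))
  obtain ⟨P, hP⟩ := MvPolynomial.exists_eq_map_of_forall_im_eq_zero M.det fun x => by
    rw [heval, ← Complex.conj_eq_iff_im]
    have := (Matrix.det_conjTranspose (M := pencil v fun a => (x a : ℂ))).symm
    rwa [isHermitian_pencil v x] at this
  refine ⟨P, ?_, fun z => ?_⟩
  · rw [hP] at hdeg
    convert hdeg using 1
    rw [MvPolynomial.totalDegree, MvPolynomial.totalDegree,
      MvPolynomial.support_map_of_injective _ Complex.ofReal_injective]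
  · rw [← heval, hP, MvPolynomial.eval_map]
    rfl

/-- The polynomial `det (z₀ + ∑ zₐ vₐ vₐ*)`. -/
noncomputable def pencilPoly (v : σ → n → ℂ) : MvPolynomial (Option σ) ℝ :=
  (exists_pencilPoly v).choose

theorem totalDegree_pencilPoly_le (v : σ → n → ℂ) :
    (pencilPoly v).totalDegree ≤ Fintype.card n :=
  (exists_pencilPoly v).choose_spec.1

theorem aeval_pencilPoly (v : σ → n → ℂ) (z : Option σ → ℂ) :
    MvPolynomial.aeval z (pencilPoly v) = (pencil v z).det :=
  (exists_pencilPoly v).choose_spec.2 z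

theorem ofReal_eval_pencilPoly (v : σ → n → ℂ) (z : Option σ → ℝ) :
    ((MvPolynomial.eval z (pencilPoly v) : ℝ) : ℂ) = (pencil v fun a => (z a : ℂ)).det := by
  rw [← aeval_pencilPoly, ← MvPolynomial.eval_ofReal_map, MvPolynomial.eval_map]
  rfl

theorem eval_pencilPoly_pos (v : σ → n → ℂ) (z : Option σ → ℝ)
    (h : ∀ y : n → ℂ, y ≠ 0 →
      0 < z none * ∑ b, ‖y b‖ ^ 2 + ∑ a, z (some a) * ‖star (v a) ⬝ᵥ y‖ ^ 2) :
    0 < MvPolynomial.eval z (pencilPoly v) := by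
  have := (posDef_pencil v z h).det_pos
  rw [← ofReal_eval_pencilPoly] at this
  exact_mod_cast this

/-- A kernel vector `y` at `z` would make the imaginary part of the quadratic form vanish, but it is
at least `Im z₀ ‖y‖² > 0`. Along `z + X u` the top coefficient is the determinant of the positive
definite pencil at `u`. -/
theorem isStable_pencilPoly (v : σ → n → ℂ) :
    IsStable none (Fintype.card n) (pencilPoly v) where
  aeval_ne_zero z ho hz h := by
    rw [aeval_pencilPoly, ← Matrix.exists_mulVec_eq_zero_iff] at h
    obtain ⟨y, hy, h⟩ := h
    have h1 := star_dotProduct_pencil_mulVec v z y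
    rw [h, dotProduct_zero] at h1
    have h2 := congrArg Complex.im h1
    rw [Complex.add_im, Complex.im_sum] at h2
    simp only [Complex.im_mul_ofReal, Complex.zero_im] at h2
    have h3 : 0 ≤ ∑ a, (z (some a)).im * ‖star (v a) ⬝ᵥ y‖ ^ 2 :=
      Finset.sum_nonneg fun a _ => mul_nonneg (hz _) (by positivity)
    have := mul_pos ho (sum_norm_sq_pos hy)
    linarith
  totalDegree_le := totalDegree_pencilPoly_le v
  coeff_pos z u hu huo := by
    have h1 : (linePoly z u (pencilPoly v)).map Complex.ofRealHom =
        ((X : ℂ[X]) • (pencil v fun a => (u a : ℂ)).map C +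
          (pencil v fun a => (z a : ℂ)).map C).det := by
      refine Polynomial.funext fun s => ?_
      have h2 : (pencil v fun a => (z a : ℂ) + (u a : ℂ) * s) =
          pencil v (fun a => (z a : ℂ)) + s • pencil v (fun a => (u a : ℂ)) := by
        rw [← pencil_add_smul]
        congr 1
        ext a
        simp [mul_comm]
      rw [eval_map, ← Polynomial.coe_evalRingHom, RingHom.map_det]
      trans (pencil v fun a => (z a : ℂ) + (u a : ℂ) * s).det
      · rw [← aeval_pencilPoly]
        exact aeval_linePoly z u (pencilPoly v) s
      · rw [h2]
        congr 1
        ext i j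
        simp [add_comm, mul_comm s]
    have h2 := congrArg (fun p => p.coeff (Fintype.card n)) h1
    simp only [coeff_map, Polynomial.coeff_det_X_add_C_card] at h2
    have h3 := (posDef_pencil v u fun y hy => add_pos_of_pos_of_nonneg
      (mul_pos huo (sum_norm_sq_pos hy))
      (Finset.sum_nonneg fun a _ => mul_nonneg (hu _) (by positivity))).det_pos
    rw [← h2] at h3
    exact Complex.zero_lt_real.1 h3

theorem eval_pencilPoly_add_single [DecidableEq σ] (v : σ → n → ℂ) (z : Option σ → ℝ) (a : σ)
    (hz : MvPolynomial.eval z (pencilPoly v) ≠ 0) (s : ℝ) :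
    ((MvPolynomial.eval (z + s • Pi.single (some a) 1) (pencilPoly v) : ℝ) : ℂ) =
      (MvPolynomial.eval z (pencilPoly v) : ℝ) *
        (1 + s * (star (v a) ⬝ᵥ ((pencil v fun a => (z a : ℂ))⁻¹).mulVec (v a))) := by
  have hdet : (pencil v fun a => (z a : ℂ)).det ≠ 0 := by
    rw [← ofReal_eval_pencilPoly]; exact_mod_cast hz
  have h1 : (pencil v fun b => (((z + s • Pi.single (some a) 1 : Option σ → ℝ) b : ℝ) : ℂ)) =
      pencil v (fun a => (z a : ℂ)) +
        Matrix.replicateCol Unit ((s : ℂ) • v a) * Matrix.replicateRow Unit (star (v a)) := by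
    have h2 : (fun b => (((z + s • Pi.single (some a) 1 : Option σ → ℝ) b : ℝ) : ℂ)) =
        (fun a => (z a : ℂ)) + (s : ℂ) • (Pi.single (some a) (1 : ℂ) : Option σ → ℂ) := by
      ext b
      by_cases hb : b = some a
      · subst hb; simp
      · simp [hb]
    rw [h2, pencil_add_smul, ← Matrix.vecMulVec_eq]
    congr 1
    rw [Matrix.smul_vecMulVec]
    congr 1
    simp [pencil, Pi.single_apply]
  rw [ofReal_eval_pencilPoly, ofReal_eval_pencilPoly, h1,
    Matrix.det_add_replicateCol_mul_replicateRow (isUnit_iff_ne_zero.2 hdet)]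
  congr 2
  rw [Matrix.det_unique, Matrix.add_apply, Matrix.mul_assoc, Matrix.one_apply_eq,
    Matrix.mul_apply']
  congr 1
  rw [← smul_eq_mul (s : ℂ), ← dotProduct_smul, ← Matrix.mulVec_smul]
  rfl

end

/-! ### Eigenvalue bounds, barrier bounds and shifts for the pencil polynomial. -/

section

open Polynomial Filter Topology ComplexConjugate
open scoped ComplexOrder

theorem norm_sq_star_dotProduct_le {n : Type*} [Fintype n] (x y : n → ℂ) :
    ‖star x ⬝ᵥ y‖ ^ 2 ≤ (∑ b, ‖x b‖ ^ 2) * ∑ b, ‖y b‖ ^ 2 := by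
  have h1 : ‖star x ⬝ᵥ y‖ ≤ ∑ b, ‖x b‖ * ‖y b‖ :=
    (norm_sum_le _ _).trans (by simp)
  calc ‖star x ⬝ᵥ y‖ ^ 2 ≤ (∑ b, ‖x b‖ * ‖y b‖) ^ 2 := by gcongr
    _ ≤ _ := Finset.sum_mul_sq_le_sq_mul_sq _ _ _

variable {σ n : Type*} [Fintype σ] [Fintype n] [DecidableEq n]

theorem sum_norm_sq_le_of_eval_pencilPoly_ne_zero (v : σ → n → ℂ) (w : σ → ℝ) {ρ : ℝ}
    (h : ∀ t, ρ < t → MvPolynomial.eval (fun b => b.elim t fun a => -w a) (pencilPoly v) ≠ 0)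
    (y : n → ℂ) : ∑ a, w a * ‖star (v a) ⬝ᵥ y‖ ^ 2 ≤ ρ * ∑ b, ‖y b‖ ^ 2 := by
  set z : ℝ → Option σ → ℝ := fun t b => b.elim t fun a => -w a with hz
  have hH := isHermitian_pencil v (z ρ)
  have hpsd : (pencil v fun a => (z ρ a : ℂ)).PosSemidef := by
    -- An eigenvalue `μ < 0` of the pencil at `ρ` would make the pencil singular at `ρ - μ > ρ`.
    refine hH.posSemidef_iff_eigenvalues_nonneg.2 fun i => ?_
    by_contra! hneg
    simp only [Pi.zero_apply] at hneg
    refine h (ρ - hH.eigenvalues i) (by linarith) ?_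
    have h1 := hH.mulVec_eigenvectorBasis i
    have h2 : (pencil v fun a => (z (ρ - hH.eigenvalues i) a : ℂ)) =
        (pencil v fun a => (z ρ a : ℂ)) - (hH.eigenvalues i : ℂ) • (1 : Matrix n n ℂ) := by
      simp [pencil, hz, sub_smul]
      abel
    have h3 : (pencil v fun a => (z (ρ - hH.eigenvalues i) a : ℂ)).det = 0 := by
      rw [← Matrix.exists_mulVec_eq_zero_iff]
      refine ⟨(hH.eigenvectorBasis i).ofLp, fun h0 => ?_, ?_⟩
      · exact hH.eigenvectorBasis.toBasis.ne_zero i (by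
          simpa using congrArg (WithLp.toLp 2) h0)
      · rw [h2, Matrix.sub_mulVec, h1, Matrix.smul_mulVec, Matrix.one_mulVec]
        exact sub_self _
    rw [← ofReal_eval_pencilPoly] at h3
    exact_mod_cast h3
  have h1 := hpsd.dotProduct_mulVec_nonneg y
  rw [star_dotProduct_pencil_mulVec] at h1
  have h2 : (0 : ℝ) ≤ ρ * ∑ b, ‖y b‖ ^ 2 + ∑ a, -w a * ‖star (v a) ⬝ᵥ y‖ ^ 2 := by
    have : (0 : ℂ) ≤ ((ρ * ∑ b, ‖y b‖ ^ 2 + ∑ a, -w a * ‖star (v a) ⬝ᵥ y‖ ^ 2 : ℝ) : ℂ) := by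
      convert h1 using 1
      simp [hz]
    exact_mod_cast this
  simp only [neg_mul, Finset.sum_neg_distrib] at h2
  linarith

variable [DecidableEq σ]

theorem eval_dirDeriv_pencilPoly (v : σ → n → ℂ) (z : Option σ → ℝ) (a : σ)
    (hz : MvPolynomial.eval z (pencilPoly v) ≠ 0) :
    MvPolynomial.eval z (dirDeriv (Pi.single (some a) 1) (pencilPoly v)) =
      MvPolynomial.eval z (pencilPoly v) *
        (star (v a) ⬝ᵥ ((pencil v fun a => (z a : ℂ))⁻¹).mulVec (v a)).re := by
  set β := star (v a) ⬝ᵥ ((pencil v fun a => (z a : ℂ))⁻¹).mulVec (v a) with hβ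
  set p := MvPolynomial.eval z (pencilPoly v) with hp
  have e : ∀ s : ℝ, (fun b => z b + (Pi.single (some a) 1 : Option σ → ℝ) b * s) =
      z + s • Pi.single (some a) 1 := fun s => by
    ext b; simp [mul_comm]
  have h1 : linePoly z (Pi.single (some a) 1) (pencilPoly v) = C p + C (p * β.re) * X := by
    refine Polynomial.funext fun s => ?_
    have := congrArg Complex.re (eval_pencilPoly_add_single v z a hz s)
    rw [eval_linePoly_real, e]
    simp only [Complex.ofReal_re, Complex.re_ofReal_mul, Complex.add_re, Complex.one_re] at this
    rw [this]
    simp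
    ring
  have h2 := congrArg (fun q => (derivative q).eval 0) h1
  simpa [derivative_linePoly, eval_linePoly_real] using h2

/-- The barrier is `Q = vᴴ M⁻¹ v` with `M ≥ m`. For `y = M⁻¹ v` one has `Q = yᴴ M y ≥ m ‖y‖²`, and
Cauchy–Schwarz gives `Q² ≤ ‖v‖² ‖y‖²`, hence `m Q ≤ ‖v‖²`. -/
theorem barrier_pencilPoly_le (v : σ → n → ℂ) (z : Option σ → ℝ) (a : σ) {m : ℝ} (hm : 0 < m)
    (h : ∀ y : n → ℂ, m * ∑ b, ‖y b‖ ^ 2 ≤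
      z none * ∑ b, ‖y b‖ ^ 2 + ∑ a, z (some a) * ‖star (v a) ⬝ᵥ y‖ ^ 2) :
    barrier (Pi.single (some a) 1) (pencilPoly v) z ≤ (∑ b, ‖v a b‖ ^ 2) / m := by
  have hpd : ∀ y : n → ℂ, y ≠ 0 →
      0 < z none * ∑ b, ‖y b‖ ^ 2 + ∑ a, z (some a) * ‖star (v a) ⬝ᵥ y‖ ^ 2 := fun y hy =>
    (mul_pos hm (sum_norm_sq_pos hy)).trans_le (h y)
  have hz := eval_pencilPoly_pos v z hpd
  have hdet : IsUnit (pencil v fun a => (z a : ℂ)).det := by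
    rw [← ofReal_eval_pencilPoly, isUnit_iff_ne_zero]
    exact_mod_cast hz.ne'
  rw [barrier, eval_dirDeriv_pencilPoly v z a hz.ne', mul_div_cancel_left₀ _ hz.ne']
  set M := pencil v fun a => (z a : ℂ) with hM
  set y := M⁻¹.mulVec (v a) with hy
  have hMy : M.mulVec y = v a := by
    rw [hy, Matrix.mulVec_mulVec, Matrix.mul_nonsing_inv _ hdet, Matrix.one_mulVec]
  have h1 : star (v a) ⬝ᵥ y = star (star y ⬝ᵥ M.mulVec y) := by
    rw [hMy, Matrix.star_dotProduct]
  have h2 := star_dotProduct_pencil_mulVec v (fun a => (z a : ℂ)) y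
  set Q := z none * ∑ b, ‖y b‖ ^ 2 + ∑ a, z (some a) * ‖star (v a) ⬝ᵥ y‖ ^ 2 with hQ
  have h3 : star y ⬝ᵥ M.mulVec y = (Q : ℂ) := by
    rw [h2, hQ]; push_cast; rfl
  have h4 : star (v a) ⬝ᵥ y = (Q : ℂ) := by
    rw [h1, h3]; exact Complex.conj_ofReal Q
  have h5 := norm_sq_star_dotProduct_le (v a) y
  rw [h4, Complex.norm_real, Real.norm_eq_abs, sq_abs] at h5
  rw [h4, Complex.ofReal_re, le_div_iff₀ hm]
  have h6 := h y
  have h7 : 0 ≤ ∑ b, ‖y b‖ ^ 2 := by positivity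
  have h8 : 0 ≤ ∑ b, ‖v a b‖ ^ 2 := by positivity
  rw [← hQ] at h6
  rcases (mul_nonneg hm.le h7 |>.trans h6).eq_or_lt with h9 | h9
  · rw [← h9]; simpa using h8
  · refine le_of_mul_le_mul_left ?_ h9
    nlinarith [mul_le_mul_of_nonneg_left h6 h8, mul_le_mul_of_nonneg_left h5 hm.le]

/-- The pencil polynomial is affine in each of the variables of its rank one terms. -/
theorem eval_subDirDeriv_pencilPoly (v : σ → n → ℂ) (z : Option σ → ℝ) (a : σ) :
    MvPolynomial.eval z (subDirDeriv (Pi.single (some a) 1) (pencilPoly v)) =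
      MvPolynomial.eval (z - Pi.single (some a) 1) (pencilPoly v) := by
  set e₀ : Option σ → ℝ := Pi.single none 1 with he₀
  set e₁ : Option σ → ℝ := Pi.single (some a) 1 with he₁
  have e : ∀ (z : Option σ → ℝ) (s : ℝ), (fun b => z b + e₀ b * s) = z + s • e₀ := fun z s => by
    ext b; simp [mul_comm]
  have hne : linePoly z e₀ (pencilPoly v) ≠ 0 := fun h => by
    have := (isStable_pencilPoly v).coeff_pos z e₀
      (fun b => by by_cases hb : b = none <;> simp [he₀, hb]) (by simp [he₀])
    rw [h] at this
    simp at this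
  -- The determinant formula needs an invertible pencil. Moving along `z₀` excludes only finitely
  -- many points, and a polynomial identity extends across them.
  have key : linePoly z e₀ (subDirDeriv e₁ (pencilPoly v)) =
      linePoly (z - e₁) e₀ (pencilPoly v) := by
    refine Polynomial.eq_of_infinite_eval_eq _ _ (Set.Infinite.mono ?_
      (Set.Finite.infinite_compl ((linePoly z e₀ (pencilPoly v)).roots.toFinset.finite_toSet)))
    intro s hs
    have hs : MvPolynomial.eval (z + s • e₀) (pencilPoly v) ≠ 0 := by
      simpa [hne, eval_linePoly_real, e] using hs
    have h1 := congrArg Complex.re (eval_pencilPoly_add_single v _ a hs (-1))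
    have h2 := eval_dirDeriv_pencilPoly v _ a hs
    have h3 : z + s • e₀ + (-1 : ℝ) • e₁ = z - e₁ + s • e₀ := by
      rw [neg_one_smul]; abel
    rw [← he₁] at h2
    rw [← he₁, h3] at h1
    simp only [Complex.ofReal_re, Complex.re_ofReal_mul, Complex.add_re, Complex.one_re] at h1
    simp only [Set.mem_ofPred_eq, eval_linePoly_real, e, subDirDeriv, map_sub]
    rw [h1, h2]
    ring
  have := congrArg (fun p => p.eval 0) key
  simp only [eval_linePoly_real, mul_zero, add_zero] at this
  exact this

/-- Translation commutes with directional derivatives, so the one-step shifts accumulate. -/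
theorem eval_foldr_subDirDeriv_pencilPoly (v : σ → n → ℂ) (l : List σ) (z : Option σ → ℝ) :
    MvPolynomial.eval z
      ((l.map fun a => Pi.single (some a) (1 : ℝ)).foldr subDirDeriv (pencilPoly v)) =
      MvPolynomial.eval (z - (l.map fun a => Pi.single (some a) (1 : ℝ)).sum) (pencilPoly v) := by
  induction l generalizing z with
  | nil => simp
  | cons a l ih =>
    set S := (l.map fun a => (Pi.single (some a) (1 : ℝ) : Option σ → ℝ)).sum with hS
    set g := (l.map fun a => Pi.single (some a) (1 : ℝ)).foldr subDirDeriv (pencilPoly v) with hg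
    have h1 : linePoly z (Pi.single (some a) 1) g =
        linePoly (z - S) (Pi.single (some a) 1) (pencilPoly v) := by
      refine Polynomial.funext fun s => ?_
      rw [eval_linePoly_real, eval_linePoly_real, ih]
      congr 2
      ext b
      simp only [Pi.sub_apply]
      ring
    have h2 := congrArg (fun p => (derivative p).eval 0) h1
    simp only [derivative_linePoly, eval_linePoly_real, mul_zero, add_zero] at h2
    have h3 := eval_subDirDeriv_pencilPoly v (z - S) a
    simp only [subDirDeriv, map_sub] at h3
    rw [List.map_cons, List.foldr_cons, List.sum_cons, ← hg, subDirDeriv, map_sub, ih, ← hS]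
    rw [show z - (Pi.single (some a) 1 + S) = z - S - Pi.single (some a) 1 by abel, ← h3, h2]

end

/-! ### The Marcus–Spielman–Srivastava theorem. -/

section

open Polynomial Filter Topology ComplexConjugate

/-- The theorem of Marcus, Spielman and Srivastava on sums of independent random rank one
matrices. -/
theorem exists_choice_sum_norm_sq_le {ι κ n : Type*} [Fintype ι] [Fintype κ] [Fintype n]
    (v : ι → κ → n → ℂ) {p : κ → ℝ} (hp : ∀ k, 0 ≤ p k) (hp1 : ∑ k, p k = 1) {ε : ℝ}
    (hε : 0 ≤ ε)
    (h1 : ∀ y : n → ℂ, ∑ i, ∑ k, p k * ‖star (v i k) ⬝ᵥ y‖ ^ 2 ≤ ∑ b, ‖y b‖ ^ 2)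
    (h2 : ∀ i, ∑ k, p k * ∑ b, ‖v i k b‖ ^ 2 ≤ ε) :
    ∃ c : ι → κ, ∀ y : n → ℂ,
      ∑ i, ‖star (v i (c i)) ⬝ᵥ y‖ ^ 2 ≤ (1 + √ε) ^ 2 * ∑ b, ‖y b‖ ^ 2 := by
  classical
  have hκ : Nonempty κ := by
    by_contra hempty
    rw [not_nonempty_iff] at hempty
    simp at hp1
  rcases isEmpty_or_nonempty n with hn | hn
  · exact ⟨fun _ => Classical.arbitrary κ, fun y => by simp [dotProduct]⟩
  have hN : 0 < Fintype.card n := Fintype.card_pos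
  set V : ι × κ → n → ℂ := fun a => v a.1 a.2 with hV
  set e₀ : Option (ι × κ) → ℝ := Pi.single none 1 with he₀
  set w : ι → κ → Option (ι × κ) → ℝ := fun i k => Pi.single (some (i, k)) 1 with hw
  set W : ι → Option (ι × κ) → ℝ := fun i => ∑ k, p k • w i k with hW
  have he₀nn : ∀ a, 0 ≤ e₀ a := fun a => by by_cases ha : a = none <;> simp [he₀, ha]
  have hwnn : ∀ i k a, 0 ≤ w i k a := fun i k a => by
    by_cases ha : a = some (i, k) <;> simp [hw, ha]
  have hWnn : ∀ i a, 0 ≤ W i a := fun i a => by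
    change 0 ≤ (∑ k, p k • w i k) a
    rw [Finset.sum_apply]
    exact Finset.sum_nonneg fun k _ => mul_nonneg (hp k) (hwnn i k a)
  have hs : 0 ≤ √ε := Real.sqrt_nonneg ε
  have hss : √ε * √ε = ε := Real.mul_self_sqrt hε
  have hstable := isStable_pencilPoly V
  have hWsome : ∀ i k, (∑ j, W j) (some (i, k)) = p k := by
    intro i k
    simp [hW, hw, Finset.sum_apply, Pi.single_apply, Prod.ext_iff, ite_and]
  have hWnone : (∑ j, W j) none = 0 := by
    simp [hW, hw, Finset.sum_apply]
  have hpos : ∀ x, (1 + √ε) ^ 2 < x → 0 < MvPolynomial.eval (0 + x • e₀)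
      ((Finset.univ.toList.map W).foldr subDirDeriv (pencilPoly V)) := by
    intro x hx
    -- The barrier argument runs with `d = 1 + √ε` and ends at `x • e₀`. At this start the pencil is
    -- at least `x - (1 + √ε) > √ε (1 + √ε)` when `ε > 0`, which makes the barriers at most `√ε / (1
    -- + √ε) = 1 - 1 / d`; for `ε = 0` both bounds are `0`.
    set z : Option (ι × κ) → ℝ := x • e₀ - (1 + √ε) • ∑ i, W i with hz
    have hm : 0 < x - (1 + √ε) := by nlinarith
    have hznone : z none = x := by
      simp [hz, hWnone, he₀]
    have hzsome : ∀ a, z (some a) = -((1 + √ε) * p a.2) := by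
      rintro ⟨i, k⟩
      simp only [hz, Pi.sub_apply, Pi.smul_apply, smul_eq_mul, hWsome]
      simp [he₀]
    have hform : ∀ y : n → ℂ, (x - (1 + √ε)) * ∑ b, ‖y b‖ ^ 2 ≤
        z none * ∑ b, ‖y b‖ ^ 2 + ∑ a, z (some a) * ‖star (V a) ⬝ᵥ y‖ ^ 2 := by
      intro y
      have h3 : ∑ a, z (some a) * ‖star (V a) ⬝ᵥ y‖ ^ 2 =
          -((1 + √ε) * ∑ i, ∑ k, p k * ‖star (v i k) ⬝ᵥ y‖ ^ 2) := by
        rw [Fintype.sum_prod_type]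
        simp only [hzsome, Finset.mul_sum, ← Finset.sum_neg_distrib]
        exact Finset.sum_congr rfl fun i _ => Finset.sum_congr rfl fun k _ => by ring
      rw [h3, hznone]
      nlinarith [h1 y]
    have habove : IsAbove (pencilPoly V) z := by
      intro z' hzz'
      refine eval_pencilPoly_pos V z' fun y hy => ?_
      refine ((mul_pos hm (sum_norm_sq_pos hy)).trans_le (hform y)).trans_le ?_
      gcongr with a
      · exact hzz' none
      · exact hzz' (some a)
    have hbar : ∀ i, barrier (W i) (pencilPoly V) z ≤ 1 - 1 / (1 + √ε) := by
      intro i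
      have h3 : barrier (W i) (pencilPoly V) z =
          ∑ k, p k * barrier (w i k) (pencilPoly V) z := by
        have hD : dirDeriv (W i) (pencilPoly V) = ∑ k, p k • dirDeriv (w i k) (pencilPoly V) := by
          simp only [hW, dirDeriv_apply_eq_sum, Finset.sum_apply, Finset.sum_smul, Finset.smul_sum]
          rw [Finset.sum_comm]
          simp [smul_smul]
        simp only [barrier, hD, map_sum, MvPolynomial.smul_eval, Finset.sum_div, mul_div_assoc]
      calc barrier (W i) (pencilPoly V) z
          ≤ ∑ k, p k * ((∑ b, ‖v i k b‖ ^ 2) / (x - (1 + √ε))) := by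
            rw [h3]
            gcongr with k
            · exact hp k
            · exact barrier_pencilPoly_le V z (i, k) hm hform
        _ = (∑ k, p k * ∑ b, ‖v i k b‖ ^ 2) / (x - (1 + √ε)) := by
            simp only [Finset.sum_div, mul_div_assoc]
        _ ≤ ε / (x - (1 + √ε)) := by gcongr; exact h2 i
        _ ≤ 1 - 1 / (1 + √ε) := by
            rw [one_sub_div (by positivity), div_le_div_iff₀ hm (by positivity)]
            nlinarith [mul_nonneg hs hs, mul_nonneg hs (sub_nonneg.2 hx.le)]
    have h3 := hstable.isAbove_foldr hN habove (d := 1 + √ε) (by positivity)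
      (l := Finset.univ.toList.map W)
      (fun w' hw' => by
        obtain ⟨i, -, rfl⟩ := List.mem_map.1 hw'
        exact hWnn i)
      (fun w' hw' => by
        obtain ⟨i, -, rfl⟩ := List.mem_map.1 hw'
        exact hbar i)
    have h4 := h3 _ le_rfl
    rwa [Finset.sum_map_toList, hz, sub_add_cancel, ← zero_add (x • e₀)] at h4
  obtain ⟨c, hc⟩ := hstable.exists_choice_foldr hN hwnn hp hp1 he₀nn (by simp [he₀])
    (Finset.nodup_toList Finset.univ) hpos
  refine ⟨c, fun y => ?_⟩
  -- The indicator weights select the chosen outcomes, so the pencil becomes `t` minus the chosen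
  -- sum.
  have h3 := sum_norm_sq_le_of_eval_pencilPoly_ne_zero V
    (fun a => if c a.1 = a.2 then 1 else 0) (ρ := (1 + √ε) ^ 2) (fun t ht => ?_) y
  · rw [Fintype.sum_prod_type] at h3
    simpa [hV] using h3
  · have h4 := hc t ht
    have h5 : (Finset.univ.toList.map fun i => w i (c i)) =
        ((Finset.univ.toList.map fun i => (i, c i)).map fun a => Pi.single (some a) (1 : ℝ)) := by
      simp [hw]
    rw [h5, eval_foldr_subDirDeriv_pencilPoly, ← h5, Finset.sum_map_toList] at h4
    have h6 : 0 + t • e₀ - ∑ i, w i (c i) =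
        fun b => b.elim t fun a => -if c a.1 = a.2 then (1 : ℝ) else 0 := by
      ext b
      rcases b with _ | ⟨i, k⟩
      · simp [he₀, hw, Finset.sum_apply]
      · simp [he₀, hw, Finset.sum_apply, Pi.single_apply, ite_and, eq_comm]
    rw [h6] at h4
    exact h4.ne'

end

/-! ### Transfer to real or complex scalars, and the finite colouring theorem. -/

section

open Filter Topology ComplexConjugate

/-- The embedding of `ℝ` or `ℂ` into `ℂ`. -/
def RCLike.toComplex (𝕜 : Type*) [RCLike 𝕜] : 𝕜 →+* ℂ where
  toFun z := ⟨RCLike.re z, RCLike.im z⟩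
  map_zero' := by apply Complex.ext <;> simp
  map_one' := by apply Complex.ext <;> simp
  map_add' z w := by apply Complex.ext <;> simp
  map_mul' z w := by apply Complex.ext <;> simp

variable {𝕜 : Type*} [RCLike 𝕜]

theorem RCLike.toComplex_re (z : 𝕜) : (RCLike.toComplex 𝕜 z).re = RCLike.re z := rfl

theorem RCLike.toComplex_im (z : 𝕜) : (RCLike.toComplex 𝕜 z).im = RCLike.im z := rfl

theorem RCLike.toComplex_star (z : 𝕜) :
    RCLike.toComplex 𝕜 (star z) = star (RCLike.toComplex 𝕜 z) := by
  apply Complex.ext <;> simp [RCLike.toComplex_re, RCLike.toComplex_im]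

theorem RCLike.norm_toComplex (z : 𝕜) : ‖RCLike.toComplex 𝕜 z‖ = ‖z‖ := by
  rw [← sq_eq_sq₀ (norm_nonneg _) (norm_nonneg _), Complex.sq_norm, Complex.normSq_apply,
    RCLike.norm_sq_eq_def, RCLike.toComplex_re, RCLike.toComplex_im]

variable {n : Type*} [Fintype n]

theorem RCLike.toComplex_star_dotProduct (u y : n → 𝕜) :
    star (fun b => RCLike.toComplex 𝕜 (u b)) ⬝ᵥ (fun b => RCLike.toComplex 𝕜 (y b)) =
      RCLike.toComplex 𝕜 (star u ⬝ᵥ y) := by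
  simp only [dotProduct, map_sum, map_mul, Pi.star_apply, RCLike.toComplex_star]

/-- Over `ℝ` the real and imaginary parts of `y` contribute separately; over `ℂ` one vector
suffices. This carries the Bessel hypothesis from `𝕜` to `ℂ`. -/
theorem RCLike.exists_norm_sq_toComplex_star_dotProduct (𝕜 : Type*) [RCLike 𝕜] (y : n → ℂ) :
    ∃ a b : n → 𝕜, ∀ u : n → 𝕜, ‖star (fun i => RCLike.toComplex 𝕜 (u i)) ⬝ᵥ y‖ ^ 2 =
      ‖star u ⬝ᵥ a‖ ^ 2 + ‖star u ⬝ᵥ b‖ ^ 2 := by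
  rcases RCLike.I_eq_zero_or_im_I_eq_one (K := 𝕜) with hI | hI
  · have him : ∀ z : 𝕜, RCLike.im z = 0 := RCLike.im_eq_zero hI
    have h : ∀ (u : n → 𝕜) (x : n → ℝ), ‖star u ⬝ᵥ fun i => (x i : 𝕜)‖ ^ 2 =
        (∑ i, RCLike.re (u i) * x i) ^ 2 := by
      intro u x
      rw [RCLike.norm_sq_eq_def, him]
      simp [dotProduct, him, sq]
    refine ⟨fun i => ((y i).re : 𝕜), fun i => ((y i).im : 𝕜), fun u => ?_⟩
    rw [h, h, Complex.sq_norm, Complex.normSq_apply]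
    simp [dotProduct, RCLike.toComplex_re, RCLike.toComplex_im, him, sq]
  · refine ⟨fun i => ((y i).re : 𝕜) + ((y i).im : 𝕜) * RCLike.I, 0, fun u => ?_⟩
    have hy : y = fun i => RCLike.toComplex 𝕜 (((y i).re : 𝕜) + ((y i).im : 𝕜) * RCLike.I) := by
      ext i
      apply Complex.ext <;> simp [RCLike.toComplex_re, RCLike.toComplex_im, hI]
    conv_lhs => rw [hy]
    rw [RCLike.toComplex_star_dotProduct, RCLike.norm_toComplex]
    simp

theorem RCLike.exists_choice_sum_norm_sq_le {ι κ : Type*} [Fintype ι] [Fintype κ]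
    (v : ι → κ → n → 𝕜) {p : κ → ℝ} (hp : ∀ k, 0 ≤ p k) (hp1 : ∑ k, p k = 1) {ε : ℝ}
    (hε : 0 ≤ ε)
    (h1 : ∀ y : n → 𝕜, ∑ i, ∑ k, p k * ‖star (v i k) ⬝ᵥ y‖ ^ 2 ≤ ∑ b, ‖y b‖ ^ 2)
    (h2 : ∀ i, ∑ k, p k * ∑ b, ‖v i k b‖ ^ 2 ≤ ε) :
    ∃ c : ι → κ, ∀ y : n → 𝕜,
      ∑ i, ‖star (v i (c i)) ⬝ᵥ y‖ ^ 2 ≤ (1 + √ε) ^ 2 * ∑ b, ‖y b‖ ^ 2 := by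
  classical
  have hy : ∀ y : n → ℂ, ∑ i, ∑ k, p k *
      ‖star (fun b => RCLike.toComplex 𝕜 (v i k b)) ⬝ᵥ y‖ ^ 2 ≤ ∑ b, ‖y b‖ ^ 2 := by
    intro y
    obtain ⟨a, b, hab⟩ := RCLike.exists_norm_sq_toComplex_star_dotProduct 𝕜 y
    have hy : ∀ i, ‖y i‖ ^ 2 = ‖a i‖ ^ 2 + ‖b i‖ ^ 2 := by
      intro i
      have h3 : (fun j => RCLike.toComplex 𝕜 ((Pi.single i 1 : n → 𝕜) j)) = Pi.single i 1 := by
        ext j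
        by_cases hj : j = i
        · subst hj; simp
        · simp [hj]
      have h4 := hab (Pi.single i 1)
      rw [h3] at h4
      simpa [← Pi.single_star] using h4
    simp only [hab, hy, mul_add, Finset.sum_add_distrib]
    exact add_le_add (h1 a) (h1 b)
  obtain ⟨c, hc⟩ := _root_.exists_choice_sum_norm_sq_le
    (fun i k b => RCLike.toComplex 𝕜 (v i k b)) hp hp1 hε hy
    (fun i => by simpa only [RCLike.norm_toComplex] using h2 i)
  refine ⟨c, fun y => ?_⟩
  simpa only [RCLike.toComplex_star_dotProduct, RCLike.norm_toComplex] using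
    hc fun b => RCLike.toComplex 𝕜 (y b)

variable {H : Type*} [NormedAddCommGroup H] [InnerProductSpace 𝕜 H]

/-- The theorem `KS_r` for finite families. -/
theorem exists_coloring_sum_norm_inner_sq_le {ι : Type*} [Fintype ι] (u : ι → H)
    (hu : ∀ x : H, ∑ i, ‖inner 𝕜 x (u i)‖ ^ 2 ≤ ‖x‖ ^ 2) {δ : ℝ} (hδ : 0 ≤ δ)
    (huδ : ∀ i, ‖u i‖ ^ 2 ≤ δ) {r : ℕ} (hr : 0 < r) :
    ∃ c : ι → Fin r, ∀ (k : Fin r) (x : H), ∑ i with c i = k, ‖inner 𝕜 x (u i)‖ ^ 2 ≤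
      (1 / √(r : ℝ) + √δ) ^ 2 * ‖x‖ ^ 2 := by
  classical
  have hrR : (0 : ℝ) < r := by exact_mod_cast hr
  set E : Submodule 𝕜 H := Submodule.span 𝕜 (Set.range u) with hE
  have : FiniteDimensional 𝕜 E := FiniteDimensional.span_of_finite 𝕜 (Set.finite_range u)
  set e := stdOrthonormalBasis 𝕜 E
  set d := Module.finrank 𝕜 E
  set U : ι → E := fun i => ⟨u i, Submodule.subset_span ⟨i, rfl⟩⟩ with hU
  set g : ι → Fin d → 𝕜 := fun i b => e.repr (U i) b with hg
  have hginner : ∀ (i : ι) (x : E), star (g i) ⬝ᵥ (fun b => e.repr x b) =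
      inner 𝕜 (u i) (x : H) := by
    intro i x
    have h1 : inner 𝕜 (U i) x = inner 𝕜 (u i) (x : H) := rfl
    rw [← h1, ← e.repr.inner_map_map, EuclideanSpace.inner_eq_star_dotProduct, dotProduct_comm]
  have hgnorm : ∀ x : E, ∑ b, ‖e.repr x b‖ ^ 2 = ‖(x : H)‖ ^ 2 := by
    intro x
    rw [← EuclideanSpace.norm_sq_eq, e.repr.norm_map]
    rfl
  have hgy : ∀ y : Fin d → 𝕜, ∑ i, ‖star (g i) ⬝ᵥ y‖ ^ 2 ≤ ∑ b, ‖y b‖ ^ 2 := by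
    intro y
    obtain ⟨x, hx⟩ : ∃ x : E, (fun b => e.repr x b) = y :=
      ⟨e.repr.symm (WithLp.toLp 2 y), by simp⟩
    subst hx
    simp only [hginner, hgnorm]
    simpa only [norm_inner_symm] using hu x
  -- One block per colour. The factor `√r` cancels the probability `1 / r` in the expected sum and
  -- makes the squared norm `r ‖u i‖²`.
  set v : ι → Fin r → Fin d × Fin r → 𝕜 := fun i k b =>
    if b.2 = k then ((√(r : ℝ) : ℝ) : 𝕜) * g i b.1 else 0 with hv
  have hvy : ∀ i k (y : Fin d × Fin r → 𝕜), ‖star (v i k) ⬝ᵥ y‖ ^ 2 =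
      r * ‖star (g i) ⬝ᵥ (fun b => y (b, k))‖ ^ 2 := by
    intro i k y
    have : star (v i k) ⬝ᵥ y = ((√(r : ℝ) : ℝ) : 𝕜) * (star (g i) ⬝ᵥ (fun b => y (b, k))) := by
      simp only [dotProduct, Fintype.sum_prod_type, hv, Pi.star_apply, Finset.mul_sum]
      refine Finset.sum_congr rfl fun b _ => ?_
      rw [Finset.sum_eq_single k]
      · simp [mul_assoc]
      · intro k' _ hk'; simp [hk']
      · simp
    rw [this, norm_mul, mul_pow, RCLike.norm_ofReal, sq_abs, Real.sq_sqrt hrR.le]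
  have hv1 : ∀ y : Fin d × Fin r → 𝕜, ∑ i, ∑ k, 1 / (r : ℝ) * ‖star (v i k) ⬝ᵥ y‖ ^ 2 ≤
      ∑ b, ‖y b‖ ^ 2 := by
    intro y
    simp only [hvy]
    have h1 : ∀ (i : ι) (k : Fin r), 1 / (r : ℝ) * (r * ‖star (g i) ⬝ᵥ fun b => y (b, k)‖ ^ 2) =
        ‖star (g i) ⬝ᵥ fun b => y (b, k)‖ ^ 2 := fun i k => by field_simp
    simp only [h1]
    rw [Finset.sum_comm, Fintype.sum_prod_type, Finset.sum_comm (s := (Finset.univ : Finset (Fin d)))]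
    exact Finset.sum_le_sum fun k _ => hgy _
  have hv2 : ∀ i, ∑ k, 1 / (r : ℝ) * ∑ b, ‖v i k b‖ ^ 2 ≤ r * δ := by
    intro i
    have h1 : ∀ k, ∑ b, ‖v i k b‖ ^ 2 = r * ‖u i‖ ^ 2 := by
      intro k
      rw [← hgnorm (U i), Fintype.sum_prod_type, Finset.mul_sum]
      refine Finset.sum_congr rfl fun b _ => ?_
      rw [Finset.sum_eq_single k]
      · simp [hv, hg, mul_pow, Real.sq_sqrt hrR.le]
      · intro k' _ hk'; simp [hv, hk']
      · simp
    simp only [h1]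
    rw [Finset.sum_const, Finset.card_univ, Fintype.card_fin, nsmul_eq_mul]
    have := mul_le_mul_of_nonneg_left (huδ i) hrR.le
    field_simp
    linarith [huδ i]
  obtain ⟨c, hc⟩ := RCLike.exists_choice_sum_norm_sq_le v (p := fun _ => 1 / (r : ℝ))
    (fun _ => by positivity) (by simp [hrR.ne']) (ε := r * δ) (by positivity) hv1 hv2
  refine ⟨c, fun k x => ?_⟩
  set P := E.orthogonalProjectionOnto x
  have hx : ∀ i, inner 𝕜 x (u i) = inner 𝕜 (P : H) (u i) := fun i => by
    have := E.inner_orthogonalProjectionOnto_eq_of_mem_right (U i) x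
    exact this.symm
  -- A test vector supported in block `k` sees only the indices of colour `k`.
  have h1 := hc fun b => if b.2 = k then e.repr P b.1 else 0
  have h2 : ∑ b : Fin d × Fin r, ‖(if b.2 = k then e.repr P b.1 else 0 : 𝕜)‖ ^ 2 =
      ‖(P : H)‖ ^ 2 := by
    rw [← hgnorm, Fintype.sum_prod_type]
    refine Finset.sum_congr rfl fun b _ => ?_
    rw [Finset.sum_eq_single k]
    · simp
    · intro k' _ hk'; simp [hk']
    · simp
  have h3 : ∀ i, ‖star (v i (c i)) ⬝ᵥ
      (fun b : Fin d × Fin r => (if b.2 = k then e.repr P b.1 else 0 : 𝕜))‖ ^ 2 =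
      if c i = k then r * ‖inner 𝕜 x (u i)‖ ^ 2 else 0 := by
    intro i
    rw [hvy]
    by_cases hk : c i = k
    · simp only [hk, if_true]
      rw [hginner, norm_inner_symm, hx]
    · simp [hk, dotProduct]
  rw [h2] at h1
  simp only [h3] at h1
  rw [← Finset.sum_filter, ← Finset.mul_sum] at h1
  have h4 : ‖(P : H)‖ ≤ ‖x‖ := E.norm_orthogonalProjectionOnto_apply_le x
  have h5 : (1 / √(r : ℝ) + √δ) ^ 2 = (1 + √(r * δ)) ^ 2 / r := by
    have h6 : √(r : ℝ) ^ 2 = r := Real.sq_sqrt hrR.le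
    rw [Real.sqrt_mul hrR.le]
    have h7 : 0 < √(r : ℝ) := Real.sqrt_pos.2 hrR
    have h8 : (1 / √(r : ℝ) + √δ) ^ 2 * √(r : ℝ) ^ 2 = (1 + √(r : ℝ) * √δ) ^ 2 := by
      field_simp
    rw [eq_div_iff hrR.ne', ← h8, h6]
  rw [h5, div_mul_eq_mul_div, le_div_iff₀ hrR, mul_comm]
  refine h1.trans ?_
  gcongr

end

/-! ### Infinite families, by compactness of the space of colourings. -/

theorem mainTheorem5 {𝕜 H ι : Type*} [RCLike 𝕜] [NormedAddCommGroup H] [InnerProductSpace 𝕜 H]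
    [CompleteSpace H] [TopologicalSpace.SeparableSpace H] [Countable ι]
    (u : ι → H) (hu : IsBesselSequence 𝕜 u 1)
    (δ : ℝ) (hδ : 0 ≤ δ) (huδ : ∀ i, ‖u i‖ ^ 2 ≤ δ)
    (r : ℕ) (hr : 0 < r) :
    ∃ P : Fin r → Set ι, IsPartitionInto r P ∧
      ∀ k, IsBesselSequence 𝕜 (fun i : P k => u i) ((1 / √(r : ℝ) + √δ) ^ 2) := by
  classical
  set C : ℝ := (1 / √(r : ℝ) + √δ) ^ 2 with hC
  -- The colourings that are good on `J` form a closed set, since each condition involves finitely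
  -- many colours; these sets shrink as `J` grows, and a point common to all of them is the required
  -- colouring.
  set S : Finset ι → Set (ι → Fin r) := fun J => {c | ∀ (k : Fin r) (x : H),
    ∑ i ∈ J with c i = k, ‖inner 𝕜 x (u i)‖ ^ 2 ≤ C * ‖x‖ ^ 2} with hS
  have hanti : ∀ J K : Finset ι, J ⊆ K → S K ⊆ S J := by
    intro J K hJK c hc k x
    refine (Finset.sum_le_sum_of_subset_of_nonneg (Finset.filter_subset_filter _ hJK)
      fun _ _ _ => by positivity).trans (hc k x)
  have hclosed : ∀ J, IsClosed (S J) := by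
    intro J
    simp only [hS, Set.ofPred_forall]
    refine isClosed_iInter fun k => isClosed_iInter fun x => ?_
    simp only [Finset.sum_filter]
    refine isClosed_le (continuous_finsetSum _ fun i _ => ?_) continuous_const
    exact (continuous_of_discreteTopology (f := fun j : Fin r =>
      if j = k then ‖inner 𝕜 x (u i)‖ ^ 2 else 0)).comp (continuous_apply i)
  have hne : ∀ J, (S J).Nonempty := by
    intro J
    have hJ : ∀ x : H, ∑ i : J, ‖inner 𝕜 x (u i)‖ ^ 2 ≤ ‖x‖ ^ 2 := by
      intro x
      have h1 := (hu x).2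
      rw [one_mul] at h1
      refine le_trans ?_ h1
      rw [Finset.sum_coe_sort J fun i => ‖inner 𝕜 x (u i)‖ ^ 2]
      exact (hu x).1.sum_le_tsum _ fun _ _ => by positivity
    obtain ⟨c, hc⟩ := exists_coloring_sum_norm_inner_sq_le (𝕜 := 𝕜) (fun i : J => u i) hJ hδ
      (fun i => huδ i) hr
    -- The colour outside `J` is irrelevant; `0` is available because `r > 0`.
    refine ⟨fun i => if h : i ∈ J then c ⟨i, h⟩ else ⟨0, hr⟩, fun k x => ?_⟩
    refine le_trans (le_of_eq ?_) (hc k x)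
    rw [Finset.sum_filter, Finset.sum_filter, ← Finset.sum_coe_sort J]
    refine Finset.sum_congr rfl fun i _ => ?_
    simp
  obtain ⟨c, hc⟩ := IsCompact.nonempty_iInter_of_directed_nonempty_isCompact_isClosed S
    (fun J K => ⟨J ∪ K, hanti _ _ Finset.subset_union_left, hanti _ _ Finset.subset_union_right⟩)
    hne (fun J => (hclosed J).isCompact) hclosed
  rw [Set.mem_iInter] at hc
  refine ⟨fun k => {i | c i = k}, ⟨fun j k hjk => ?_, ?_⟩, fun k x => ?_⟩
  · rw [Set.disjoint_left]
    rintro i rfl h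
    exact hjk h
  · ext i; simp
  · have hsum : Summable fun i : {i | c i = k} => ‖inner 𝕜 x (u i)‖ ^ 2 :=
      (hu x).1.comp_injective Subtype.val_injective
    refine ⟨hsum, hsum.tsum_le_of_sum_le fun J => ?_⟩
    refine le_trans (le_of_eq ?_) (hc (J.map (Function.Embedding.subtype _)) k x)
    rw [Finset.filter_true_of_mem, Finset.sum_map]
    · rfl
    · intro i hi
      obtain ⟨j, -, rfl⟩ := Finset.mem_map.1 hi
      exact j.2
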